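/- Let $\mathcal H=\mathbb C^d$ be a finite-dimensional Hilbert space, let $\{M_{sp}\}_{s\in\mathcal S,p\in\mathcal P}$ and $\{M_x\}_{x\in\mathcal X}$ be POVMs on $\mathcal H$ with finite outcome sets, and put $M_p=\sum_s M_{sp}$. For $\rho\ge 0$ let $$W(\rho)=\sum_{s,p}H\big(\sqrt{M_{sp}}\,\rho\,\sqrt{M_{sp}}\big)-\sum_pH\big(\sqrt{M_p}\,\rho\,\sqrt{M_p}\big),\qquad H(\omega)=-\mathrm{Tr}(\omega\log_2\omega)$$ (for a state $\rho$ this is the conditional entropy of the outcome $s$ given the outcome $p$ and a purifying system of $\rho$), and let $\Phi_M(\rho)=(\mathrm{Tr}(\rho M_x))_{x\in\mathcal X}\in\mathbb R^{\mathcal X}$. Let $c_0\ge 0$, $c_1>0$, and let $q_0\in\mathbb R^{\mathcal X}$ be a probability vector. Consider the problem $$h_{\rm primal}(q_0)=\inf\Big\{W(\rho)-\sqrt{c_0^2-\|q_0-\Phi_M(\rho)\|_1^2/(4c_1^2)}\;:\;\mathrm{Tr}\,\rho=1,\ \rho\ge0,\ \|q_0-\Phi_M(\rho)\|_1\le 2c_0c_1\Big\}.$$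 Its Fenchel dual problem is $$h_{\rm dual}(q_0)=\sup\Big\{q_0\cdot f-c_0\sqrt{1+c_1^2(\max f-\min f)^2}\;:\;f\in\mathbb R^{\mathcal X},\ f\cdot\Phi_M(\rho)\le W(\rho)\ \text{for all states }\rho\Big\}.$$ Precisely, extend $\Phi_M$ to the real-linear map $\sigma\mapsto(\mathrm{Re}\,\mathrm{Tr}(\sigma M_x))_x$ on all complex $d\times d$ matrices with the inner product $\mathrm{Re}\,\mathrm{Tr}(A^\dagger B)$, with adjoint $\Phi_M^\dagger(v)=\sum_x v(x)M_x$. Let $F(\rho)=W(\rho)$ if $\rho\ge0$ and $F(\rho)=+\infty$ otherwise. Let $G(\lambda)=-\sqrt{c_0^2-\|\lambda-q_0\|_1^2/(4c_1^2)}$ if $\sum_x(\lambda-q_0)(x)=0$ and $\|\lambda-q_0\|_1\le2c_0c_1$, and $G(\lambda)=+\infty$ otherwise. Denote the Fenchel conjugate by $h^*(v)=\sup_x(\langle v,x\rangle-h(x))$. Then the primal objective, extended by $+\infty$ outside the feasible set, equals $F(\rho)+G(\Phi_M(\rho))$ for every $\rho$, and the dual objective, extended by $-\infty$ outside the feasible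 set, equals $-F^*(\Phi_M^\dagger v)-G^*(-v)$ for every $v\in\mathbb R^{\mathcal X}$. Consequently $h_{\rm primal}(q_0)=\inf_\rho\{F(\rho)+G(\Phi_M(\rho))\}$ and $h_{\rm dual}(q_0)=\sup_v\{-F^*(\Phi_M^\dagger v)-G^*(-v)\}$. Moreover, if there is a state $\sigma$ (that is, $\sigma\ge0$, $\mathrm{Tr}\,\sigma=1$) with $\Phi_M(\sigma)=q_0$, then $h_{\rm primal}(q_0)=h_{\rm dual}(q_0)$. -/

import Mathlib

open scoped Matrix ComplexOrder

noncomputable section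

/-! ## Quantum measurements and the conditional entropy function -/

section Quantum

variable {n X S P : Type*} [Fintype n] [DecidableEq n] [Fintype X] [Fintype S] [Fintype P]

/-- A positive operator-valued measure on the Hilbert space `ℂⁿ` with outcomes in `X`. -/
structure IsPOVM (M : X → Matrix n n ℂ) : Prop where
  posSemidef : ∀ x, (M x).PosSemidef
  sum_eq_one : ∑ x, M x = 1

/-- The set of density operators (quantum states) on `ℂⁿ`. -/
def densityOperators (n : Type*) [Fintype n] [DecidableEq n] : Set (Matrix n n ℂ) :=
  {ρ | ρ.PosSemidef ∧ ρ.trace = 1}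

/-- The von Neumann entropy `H(ω) = -Tr(ω log₂ ω)` of a positive semidefinite operator (not
necessarily of trace one), with `0 log₂ 0 = 0`. -/
def vnEntropy (ω : Matrix n n ℂ) : ℝ :=
  (Matrix.trace (cfc (fun t : ℝ => -(t * Real.logb 2 t)) ω)).re

/-- The map `ρ ↦ K ρ K†` with `K = √E`, for a positive semidefinite `E`. -/
def sqrtConj (E ρ : Matrix n n ℂ) : Matrix n n ℂ :=
  cfc Real.sqrt E * ρ * (cfc Real.sqrt E)ᴴ

/-- The quantum conditional entropy function
`W(ρ) = ∑_{s,p} H(K_{sp} ρ K_{sp}†) - ∑_p H(K_p ρ K_p†)`, where `K_{sp} = √M_{sp}`,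
`K_p = √M_p`, `M_p = ∑_s M_{sp}`. -/
def condEntropyFun (N : S × P → Matrix n n ℂ) (ρ : Matrix n n ℂ) : ℝ :=
  ∑ s, ∑ p, vnEntropy (sqrtConj (N (s, p)) ρ)
    - ∑ p, vnEntropy (sqrtConj (∑ s, N (s, p)) ρ)

/-- The measurement map `Φ_M(σ) = (Tr(σ M_x))_x`, as a real-linear map on all complex matrices
(`Tr(σ M_x)` is real for Hermitian `σ`; on other matrices its real part is taken). -/
def measMap (M : X → Matrix n n ℂ) : Matrix n n ℂ →ₗ[ℝ] (X → ℝ) where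
  toFun σ := fun x => (Matrix.trace (σ * M x)).re
  map_add' σ τ := by
    funext x
    simp [Matrix.add_mul]
  map_smul' c σ := by
    funext x
    simp

/-- The adjoint `Φ_M†(v) = ∑_x v(x) M_x` of the measurement map. -/
def measMapAdjoint (M : X → Matrix n n ℂ) : (X → ℝ) →ₗ[ℝ] Matrix n n ℂ where
  toFun v := ∑ x, v x • M x
  map_add' v w := by simp [add_smul, Finset.sum_add_distrib]
  map_smul' c v := by simp [mul_smul, Finset.smul_sum]

/-- The real inner product `⟨A, B⟩ = Re Tr(A† B)`, i.e. the Euclidean inner product of the vectors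
of real and imaginary parts of the entries. -/
def hsInner (A B : Matrix n n ℂ) : ℝ := (Matrix.trace (Aᴴ * B)).re

/-- `measMapAdjoint M` is the adjoint of `measMap M`. -/
theorem hsInner_measMapAdjoint {M : X → Matrix n n ℂ} (hM : IsPOVM M) (v : X → ℝ)
    (σ : Matrix n n ℂ) : hsInner (measMapAdjoint M v) σ = v ⬝ᵥ measMap M σ := by
  have h : ∀ x, (M x)ᴴ = M x := fun x => (hM.posSemidef x).isHermitian
  simp [hsInner, measMapAdjoint, measMap, dotProduct, Matrix.conjTranspose_sum,
    Matrix.sum_mul, Matrix.trace_sum, h, Matrix.trace_mul_comm σ]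

end Quantum

/-! ## Fenchel duality -/

section Fenchel

variable {V U : Type*}

open Classical in
/-- The extended-value extension of `φ` restricted to `C`: it is `+∞` outside `C`. -/
def extendTop (C : Set V) (φ : V → ℝ) (x : V) : EReal := if x ∈ C then (φ x : EReal) else ⊤

open Classical in
/-- The extension by `-∞` outside `C` (used for maximization problems). -/
def extendBot (C : Set V) (φ : V → ℝ) (x : V) : EReal := if x ∈ C then (φ x : EReal) else ⊥

/-- The Fenchel conjugate `h*(v) = sup_x (⟨v, x⟩ - h(x))` for the inner product `ip`. -/
def fenchelConj (ip : V → V → ℝ) (h : V → EReal) (v : V) : EReal :=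
  ⨆ x, ((ip v x : ℝ) : EReal) - h x

/-- The objective `f(x) + g(A x)` of the primal Fenchel problem (to be minimized over `x`). -/
def fenchelPrimalObj (f : V → EReal) (g : U → EReal) (A : V → U) (x : V) : EReal :=
  f x + g (A x)

/-- The objective `-f*(A† v) - g*(-v)` of the dual Fenchel problem (to be maximized over `v`);
`Aadj` is the adjoint of `A` for the inner products `ipV`, `ipU`. -/
def fenchelDualObj [Neg U] (ipV : V → V → ℝ) (ipU : U → U → ℝ) (f : V → EReal) (g : U → EReal)
    (Aadj : U → V) (v : U) : EReal :=
  -fenchelConj ipV f (Aadj v) - fenchelConj ipU g (-v)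

end Fenchel

/-! ## The two optimization problems -/

section Problems

variable {n X S P : Type*} [Fintype n] [DecidableEq n] [Fintype X] [Fintype S] [Fintype P]

/-- The `ℓ¹` norm on `ℝ^X`. -/
def l1Norm (v : X → ℝ) : ℝ := ∑ x, |v x|

/-- `max f - min f`. -/
def spread (f : X → ℝ) : ℝ := (⨆ x, f x) - ⨅ x, f x

/-- The feasible set of the primal problem:
`Tr ρ = 1`, `‖q₀ - Φ_M(ρ)‖₁ ≤ 2 c₀ c₁`, `ρ ≥ 0`. -/
def primalFeasible (M : X → Matrix n n ℂ) (c₀ c₁ : ℝ) (q₀ : X → ℝ) : Set (Matrix n n ℂ) :=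
  {ρ | ρ.trace = 1 ∧ l1Norm (q₀ - measMap M ρ) ≤ 2 * c₀ * c₁ ∧ ρ.PosSemidef}

/-- The primal objective `W(ρ) - √(c₀² - ‖q₀ - Φ_M(ρ)‖₁² / (4 c₁²))`. -/
def primalObj (N : S × P → Matrix n n ℂ) (M : X → Matrix n n ℂ) (c₀ c₁ : ℝ) (q₀ : X → ℝ)
    (ρ : Matrix n n ℂ) : ℝ :=
  condEntropyFun N ρ - √(c₀ ^ 2 - l1Norm (q₀ - measMap M ρ) ^ 2 / (4 * c₁ ^ 2))

/-- The optimal value of the primal problem. -/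
def hPrimal (N : S × P → Matrix n n ℂ) (M : X → Matrix n n ℂ) (c₀ c₁ : ℝ) (q₀ : X → ℝ) : EReal :=
  ⨅ ρ ∈ primalFeasible M c₀ c₁ q₀, (primalObj N M c₀ c₁ q₀ ρ : EReal)

/-- The feasible set of the dual problem: `f · Φ_M(ρ) ≤ W(ρ)` for all states `ρ`. -/
def dualFeasible (N : S × P → Matrix n n ℂ) (M : X → Matrix n n ℂ) : Set (X → ℝ) :=
  {f | ∀ ρ ∈ densityOperators n, f ⬝ᵥ measMap M ρ ≤ condEntropyFun N ρ}

/-- The dual objective `q₀ · f - c₀ √(1 + c₁² (max f - min f)²)`. -/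
def dualObj (c₀ c₁ : ℝ) (q₀ : X → ℝ) (f : X → ℝ) : ℝ :=
  q₀ ⬝ᵥ f - c₀ * √(1 + c₁ ^ 2 * spread f ^ 2)

/-- The optimal value of the dual problem. -/
def hDual (N : S × P → Matrix n n ℂ) (M : X → Matrix n n ℂ) (c₀ c₁ : ℝ) (q₀ : X → ℝ) : EReal :=
  ⨆ f ∈ dualFeasible N M, (dualObj c₀ c₁ q₀ f : EReal)

/-- `f(ρ) = W(ρ) + δ_{ρ ≥ 0}`, the first function of the Fenchel pair. -/
def fenchelF (N : S × P → Matrix n n ℂ) : Matrix n n ℂ → EReal :=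
  extendTop {ρ | ρ.PosSemidef} (condEntropyFun N)

/-- `s(x) = -√(c₀² - |x|²/c₁²)` for `|x| ≤ c₀ c₁`, and `+∞` otherwise. -/
def sFun (c₀ c₁ : ℝ) : ℝ → EReal :=
  extendTop {x | |x| ≤ c₀ * c₁} (fun x => -√(c₀ ^ 2 - |x| ^ 2 / c₁ ^ 2))

open Classical in
/-- `E(λ) = s(‖λ‖₁ / 2)` if `∑_x λ(x) = 0`, and `+∞` otherwise. -/
def penalty (c₀ c₁ : ℝ) (l : X → ℝ) : EReal :=
  if ∑ x, l x = 0 then sFun c₀ c₁ (l1Norm l / 2) else ⊤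

/-- `g(λ) = E(λ - q₀)`, the second function of the Fenchel pair. -/
def fenchelG (c₀ c₁ : ℝ) (q₀ : X → ℝ) (l : X → ℝ) : EReal := penalty c₀ c₁ (l - q₀)

end Problems

end

/-! Both Fenchel identifications are conjugate computations. `condEntropyFun` is homogeneous: the
extra terms from rescaling the entropies cancel, because `∑ s, N (s, p)` carries the same total
trace as its parts. Hence the conjugate of `fenchelF` is `0` at the dual feasible vectors and `⊤`
elsewhere. On vectors of sum zero, half the ℓ¹ norm is paired with the spread, which reduces the
conjugate of `fenchelG` to a scalar Cauchy–Schwarz inequality and its equality case. The constraint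
`Tr ρ = 1` is hidden in the sum-zero condition.

Strong duality is Sion's minimax theorem for `saddleFun`, on states against pairs (vector, upper
bound for its spread). For a fixed state the supremum over pairs recovers the primal penalty
(`exists_linear_sub_gt`). For a fixed pair the minimum over states is absorbed into the vector as an
additive constant, which gives a dual feasible point. The states are compact, and the given state
makes them nonempty.

The deep ingredient is convexity of W. Stack the operators `√N_{sp}` over `s` into a column V. The
diagonal blocks of `V ρ V†` are the `√N_{sp} ρ √N_{sp}`, and its entropy is that of `√M_p ρ √M_p`
since `V† V = M_p`. So W is a sum of entropy gains under pinching. Each gain is the relative entropy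
of T to its pinching, and relative entropy is jointly convex: it is an integral over t of quadratic
divergences, each a supremum of functions linear in the pair (A, B). -/

noncomputable section

/-! ### Entropy through eigenvalues -/

section Entropy

variable {m n : Type*} [Fintype m] [DecidableEq m] [Fintype n] [DecidableEq n]

/-- The function `t ↦ -t log₂ t`. -/
def etaTwo (t : ℝ) : ℝ := -(t * Real.logb 2 t)

theorem etaTwo_zero : etaTwo 0 = 0 := by simp [etaTwo]

theorem continuous_etaTwo : Continuous etaTwo := by
  have h : etaTwo = fun t => -(t * Real.log t) / Real.log 2 := by
    funext t
    simp only [etaTwo, Real.logb]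
    ring
  rw [h]
  exact (Real.continuous_mul_log.neg).div_const _

theorem etaTwo_mul {s t : ℝ} (hs : s ≠ 0) :
    etaTwo (s * t) = s * etaTwo t + etaTwo s * t := by
  rcases eq_or_ne t 0 with rfl | ht
  · simp [etaTwo]
  · simp only [etaTwo, Real.logb_mul hs ht]
    ring

theorem vnEntropy_eq_sum_eigenvalues {A : Matrix n n ℂ} (hA : A.IsHermitian) :
    vnEntropy A = ∑ i, etaTwo (hA.eigenvalues i) := by
  unfold vnEntropy
  rw [Matrix.IsHermitian.cfc_eq hA, Matrix.IsHermitian.cfc, Unitary.conjStarAlgAut_apply,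
    Matrix.trace_mul_comm, ← mul_assoc]
  simp [Matrix.trace_diagonal, etaTwo]

open Polynomial in
theorem roots_prod_X_sub_C_ofReal {ι : Type*} [Fintype ι] (f : ι → ℝ) :
    (∏ i, (X - C (f i : ℂ))).roots = (Finset.univ.val.map f).map ((↑) : ℝ → ℂ) := by
  rw [Multiset.map_map]
  exact roots_multiset_prod_X_sub_C (Finset.univ.val.map fun i => (f i : ℂ)) ▸ by
    rw [Multiset.map_map]; rfl

-- Compare roots. The powers of `X` allow matrices of different sizes: they pad the spectra with
-- zeros, which `etaTwo` does not see.
open Polynomial in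
theorem map_eigenvalues_eq_of_charpoly {ι : Type*} [Fintype ι] {A : Matrix n n ℂ}
    (hA : A.IsHermitian) {l : ι → ℝ} {j k : ℕ}
    (h : X ^ j * A.charpoly = X ^ k * ∏ i, (X - C (l i : ℂ))) :
    Multiset.replicate j 0 + Finset.univ.val.map hA.eigenvalues
      = Multiset.replicate k 0 + Finset.univ.val.map l := by
  have hl : (∏ i, (X - C (l i : ℂ))) ≠ 0 :=
    (monic_prod_of_monic _ _ fun i _ => monic_X_sub_C _).ne_zero
  have h2 := congrArg Polynomial.roots h
  rw [roots_mul (mul_ne_zero (pow_ne_zero _ X_ne_zero) (Matrix.charpoly_monic A).ne_zero),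
    roots_mul (mul_ne_zero (pow_ne_zero _ X_ne_zero) hl), roots_prod_X_sub_C_ofReal,
    hA.charpoly_eq, roots_X_pow, roots_X_pow, Multiset.nsmul_singleton,
    Multiset.nsmul_singleton] at h2
  have h3 := roots_prod_X_sub_C_ofReal hA.eigenvalues
  apply Multiset.map_injective Complex.ofReal_injective
  simpa [h3] using h2

open Polynomial in
theorem vnEntropy_eq_of_charpoly {ι : Type*} [Fintype ι] {A : Matrix n n ℂ}
    (hA : A.IsHermitian) {l : ι → ℝ} {j k : ℕ}
    (h : X ^ j * A.charpoly = X ^ k * ∏ i, (X - C (l i : ℂ))) :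
    vnEntropy A = ∑ i, etaTwo (l i) := by
  have h2 := congrArg (fun s => (Multiset.map etaTwo s).sum) (map_eigenvalues_eq_of_charpoly hA h)
  rw [vnEntropy_eq_sum_eigenvalues hA]
  simpa [etaTwo_zero] using h2

theorem isHermitian_conj_diagonal (U : Matrix n n ℂ) (a : n → ℝ) :
    (U * Matrix.diagonal (fun i => (a i : ℂ)) * Uᴴ).IsHermitian := by
  apply Matrix.isHermitian_mul_mul_conjTranspose
  rw [Matrix.IsHermitian, Matrix.diagonal_conjTranspose]
  congr 1
  funext i
  simp

theorem vnEntropy_conj_diagonal {U : Matrix n n ℂ} (hU : Uᴴ * U = 1) (a : n → ℝ) :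
    vnEntropy (U * Matrix.diagonal (fun i => (a i : ℂ)) * Uᴴ) = ∑ i, etaTwo (a i) := by
  apply vnEntropy_eq_of_charpoly (isHermitian_conj_diagonal U a) (j := 0) (k := 0)
  rw [Matrix.charpoly_mul_comm, ← mul_assoc, hU, one_mul, Matrix.charpoly_diagonal]

theorem exists_conj_diagonal {A : Matrix n n ℂ} (hA : A.IsHermitian) :
    ∃ U : Matrix n n ℂ, Uᴴ * U = 1 ∧ U * Uᴴ = 1 ∧
      A = U * Matrix.diagonal (fun i => (hA.eigenvalues i : ℂ)) * Uᴴ := by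
  refine ⟨hA.eigenvectorUnitary, ?_, ?_, ?_⟩
  · simpa [Matrix.star_eq_conjTranspose] using Unitary.coe_star_mul_self hA.eigenvectorUnitary
  · simpa [Matrix.star_eq_conjTranspose] using Unitary.coe_mul_star_self hA.eigenvectorUnitary
  · have := hA.spectral_theorem
    rw [Unitary.conjStarAlgAut_apply] at this
    exact this

theorem vnEntropy_smul {A : Matrix n n ℂ} (hA : A.IsHermitian) {s : ℝ} (hs : s ≠ 0) :
    vnEntropy (s • A) = s * vnEntropy A + etaTwo s * A.trace.re := by
  obtain ⟨U, hU, -, h⟩ := exists_conj_diagonal hA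
  have h1 : s • A = U * Matrix.diagonal (fun i => ((s * hA.eigenvalues i : ℝ) : ℂ)) * Uᴴ := by
    conv_lhs => rw [h]
    rw [← Matrix.smul_mul, ← Matrix.mul_smul, ← Matrix.diagonal_smul]
    congr 3
    funext i
    simp
  rw [h1, vnEntropy_conj_diagonal hU, vnEntropy_eq_sum_eigenvalues hA, hA.trace_eq_sum_eigenvalues]
  simp [etaTwo_mul hs, Finset.sum_add_distrib, Finset.mul_sum]

/-- The two products have the same nonzero spectrum: their characteristic polynomials agree up to
powers of `X`. -/
theorem vnEntropy_mul_conjTranspose (B : Matrix m n ℂ) :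
    vnEntropy (B * Bᴴ) = vnEntropy (Bᴴ * B) := by
  have h1 : (B * Bᴴ).IsHermitian := Matrix.isHermitian_mul_conjTranspose_self B
  have h2 : (Bᴴ * B).IsHermitian := Matrix.isHermitian_conjTranspose_mul_self B
  rw [vnEntropy_eq_sum_eigenvalues h2]
  apply vnEntropy_eq_of_charpoly h1 (j := Fintype.card n) (k := Fintype.card m)
  rw [Matrix.charpoly_mul_comm' B Bᴴ, h2.charpoly_eq]
  rfl

omit [DecidableEq n] in
theorem exists_conjTranspose_mul_self {ρ : Matrix n n ℂ} (hρ : ρ.PosSemidef) :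
    ∃ B : Matrix n n ℂ, ρ = Bᴴ * B := by
  classical
  open scoped MatrixOrder Matrix.Norms.L2Operator in
  exact CStarAlgebra.nonneg_iff_eq_star_mul_self.mp (Matrix.nonneg_iff_posSemidef.mpr hρ)

/-- For `ρ ≥ 0`, the entropy of `K ρ K†` depends on `K` only through `K† K`. -/
theorem vnEntropy_conj_congr {l : Type*} [Fintype l] [DecidableEq l] {K : Matrix m n ℂ}
    {R : Matrix l n ℂ} (h : Kᴴ * K = Rᴴ * R) {ρ : Matrix n n ℂ} (hρ : ρ.PosSemidef) :
    vnEntropy (K * ρ * Kᴴ) = vnEntropy (R * ρ * Rᴴ) := by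
  -- With `ρ = B† B`, the operator `K ρ K† = (K B†)(K B†)†` has the entropy of `B (K† K) B†`.
  obtain ⟨B, rfl⟩ := exists_conjTranspose_mul_self hρ
  have h1 := vnEntropy_mul_conjTranspose (K * Bᴴ)
  have h2 := vnEntropy_mul_conjTranspose (R * Bᴴ)
  simp only [Matrix.conjTranspose_mul, Matrix.conjTranspose_conjTranspose, Matrix.mul_assoc]
    at h1 h2 ⊢
  rw [h1, h2, ← Matrix.mul_assoc Kᴴ, h, Matrix.mul_assoc]

theorem continuousOn_vnEntropy :
    ContinuousOn (vnEntropy : Matrix n n ℂ → ℝ) {A | A.IsHermitian} := by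
  open scoped Matrix.Norms.L2Operator in
  have h : ContinuousOn (fun A : Matrix n n ℂ => cfc (fun t : ℝ => -(t * Real.logb 2 t)) A)
      {A | A.IsHermitian} :=
    ContinuousOn.cfc_of_mem_nhdsSet (s := Set.univ) _ Filter.univ_mem continuousOn_id
      (fun A hA => hA) continuous_etaTwo.continuousOn
  exact (Complex.continuous_re.comp (continuous_id.matrix_trace)).comp_continuousOn h

end Entropy

/-! ### Integral formula for the scalar relative entropy -/

section ScalarIntegral

open Filter Topology Set MeasureTheory

/-- Partial fractions: the integrand is `a² / (b + t a) - a / (1 + t) + (b - a) / (1 + t)²`. -/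
theorem hasDerivAt_divergence_antideriv {a b t : ℝ} (ha : 0 < a) (hb : 0 < b) (ht : 0 ≤ t) :
    HasDerivAt (fun t => a * (Real.log (b + t * a) - Real.log (1 + t)) - (b - a) / (1 + t))
      ((b - a) ^ 2 / (b + t * a) / (1 + t) ^ 2) t := by
  have h1 : 0 < b + t * a := by positivity
  have h2 : 0 < 1 + t := by positivity
  have e1 : HasDerivAt (fun t : ℝ => b + t * a) a t := by
    simpa using ((hasDerivAt_id t).mul_const a).const_add b
  have e2 : HasDerivAt (fun t : ℝ => 1 + t) 1 t := by
    simpa using (hasDerivAt_id t).const_add 1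
  convert! (((e1.log h1.ne').sub (e2.log h2.ne')).const_mul a).sub
    ((hasDerivAt_const t (b - a)).div e2 h2.ne') using 1
  field_simp
  ring

theorem tendsto_divergence_antideriv {a : ℝ} (b : ℝ) (ha : 0 < a) :
    Tendsto (fun t => a * (Real.log (b + t * a) - Real.log (1 + t)) - (b - a) / (1 + t)) atTop
      (𝓝 (a * Real.log a)) := by
  have h1 : Tendsto (fun t : ℝ => 1 + t) atTop atTop := tendsto_atTop_add_const_left _ _ tendsto_id
  have h2 : Tendsto (fun t : ℝ => (b - a) / (1 + t)) atTop (𝓝 0) := h1.const_div_atTop _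
  have h3 : Tendsto (fun t : ℝ => a + (b - a) / (1 + t)) atTop (𝓝 a) := by
    simpa using h2.const_add a
  have h4 : Tendsto (fun t : ℝ => a * Real.log (a + (b - a) / (1 + t)) - (b - a) / (1 + t)) atTop
      (𝓝 (a * Real.log a)) := by
    simpa using ((h3.log ha.ne').const_mul a).sub h2
  have h5 : Tendsto (fun t : ℝ => b + t * a) atTop atTop :=
    tendsto_atTop_add_const_left _ _ (tendsto_id.atTop_mul_const ha)
  refine h4.congr' ?_
  filter_upwards [eventually_gt_atTop 0, h5.eventually_gt_atTop 0] with t ht ht'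
  have h2 : 0 < 1 + t := by positivity
  rw [← Real.log_div ht'.ne' h2.ne']
  congr 3
  field_simp
  ring

theorem integrableOn_divergence_and_integral {a b : ℝ} (ha : 0 ≤ a) (hb : 0 < b) :
    IntegrableOn (fun t => (b - a) ^ 2 / (b + t * a) / (1 + t) ^ 2) (Ioi 0) ∧
      ∫ t in Ioi (0 : ℝ), (b - a) ^ 2 / (b + t * a) / (1 + t) ^ 2
        = a * (Real.log a - Real.log b) - a + b := by
  rcases ha.eq_or_lt with rfl | ha
  -- At `a = 0` the limit through `log a` is unavailable, but the integrand is just `b / (1 + t)²`.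
  · have hd : ∀ t ∈ Ici (0 : ℝ), HasDerivAt (fun t => -b / (1 + t))
        ((b - 0) ^ 2 / (b + t * 0) / (1 + t) ^ 2) t := by
      intro t ht
      have h2 : 0 < 1 + t := add_pos_of_pos_of_nonneg one_pos ht
      have e2 : HasDerivAt (fun t : ℝ => 1 + t) 1 t := by
        simpa using (hasDerivAt_id t).const_add 1
      convert! (hasDerivAt_const t (-b)).div e2 h2.ne' using 1
      simp only [mul_zero, add_zero, sub_zero, zero_mul, zero_sub, neg_neg, mul_one]
      field_simp
    have hl : Tendsto (fun t : ℝ => -b / (1 + t)) atTop (𝓝 0) :=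
      (tendsto_atTop_add_const_left _ _ tendsto_id).const_div_atTop _
    have hp : ∀ t ∈ Ioi (0 : ℝ), 0 ≤ (b - 0) ^ 2 / (b + t * 0) / (1 + t) ^ 2 := by
      intro t ht
      simp only [mul_zero, add_zero]
      positivity
    refine ⟨integrableOn_Ioi_deriv_of_nonneg' hd hp hl, ?_⟩
    rw [integral_Ioi_of_hasDerivAt_of_nonneg' hd hp hl]
    simp
  · have hd := fun t (ht : t ∈ Ici (0 : ℝ)) => hasDerivAt_divergence_antideriv ha hb ht
    have hp : ∀ t ∈ Ioi (0 : ℝ), 0 ≤ (b - a) ^ 2 / (b + t * a) / (1 + t) ^ 2 := by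
      intro t ht
      have := mem_Ioi.mp ht
      positivity
    have hl := tendsto_divergence_antideriv b ha
    refine ⟨integrableOn_Ioi_deriv_of_nonneg' hd hp hl, ?_⟩
    rw [integral_Ioi_of_hasDerivAt_of_nonneg' hd hp hl]
    simp
    ring

end ScalarIntegral

/-! ### Joint convexity of the relative entropy -/

section JointConvexity

variable {m : Type*} [Fintype m] [DecidableEq m]

/-- For fixed `Y`, an affine function of `(A, B)`; its supremum over `Y` is
`⟨A - B, (R_B + t L_A)⁻¹ (A - B)⟩`. -/
def affineForm (t : ℝ) (Y A B : Matrix m m ℂ) : ℝ :=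
  2 * (Matrix.trace (Yᴴ * (A - B))).re - (Matrix.trace (Yᴴ * Y * B)).re
    - t * (Matrix.trace (Yᴴ * A * Y)).re

/-- The quadratic divergence `⟨A - B, (R_B + t L_A)⁻¹ (A - B)⟩`, as a supremum. -/
def quadDivergence (t : ℝ) (A B : Matrix m m ℂ) : ℝ := ⨆ Y, affineForm t Y A B

omit [DecidableEq m] in
theorem affineForm_combo (t : ℝ) (Y A₁ B₁ A₂ B₂ : Matrix m m ℂ) (x y : ℝ) :
    affineForm t Y (x • A₁ + y • A₂) (x • B₁ + y • B₂)
      = x * affineForm t Y A₁ B₁ + y * affineForm t Y A₂ B₂ := by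
  simp only [affineForm, Matrix.mul_sub, Matrix.mul_add, Matrix.add_mul, Matrix.mul_smul,
    Matrix.smul_mul, Matrix.trace_add, Matrix.trace_sub, Matrix.trace_smul, Complex.add_re,
    Complex.sub_re, Complex.real_smul, Complex.re_ofReal_mul]
  ring

/-- Writing Y in the eigenbases of A (left) and B (right) diagonalizes `R_B + t L_A`, so the form
decouples over matrix entries. -/
theorem affineForm_diagonal (t : ℝ) {U W : Matrix m m ℂ} (hU : Uᴴ * U = 1) (hW : Wᴴ * W = 1)
    (a b : m → ℝ) (Z : Matrix m m ℂ) :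
    affineForm t (U * Z * Wᴴ) (U * Matrix.diagonal (fun i => (a i : ℂ)) * Uᴴ)
        (W * Matrix.diagonal (fun i => (b i : ℂ)) * Wᴴ)
      = ∑ i, ∑ j, (2 * ((star (Z i j) * (Uᴴ * W) i j).re * (a i - b j))
          - (b j + t * a i) * Complex.normSq (Z i j)) := by
  have e1 : Matrix.trace ((U * Z * Wᴴ)ᴴ * (U * Matrix.diagonal (fun i => (a i : ℂ)) * Uᴴ))
      = Matrix.trace (Zᴴ * (Matrix.diagonal (fun i => (a i : ℂ)) * (Uᴴ * W))) := by
    rw [Matrix.trace_mul_comm, Matrix.trace_mul_comm Zᴴ]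
    simp only [Matrix.conjTranspose_mul, Matrix.conjTranspose_conjTranspose, Matrix.mul_assoc]
    rw [Matrix.trace_mul_comm U]
    simp only [Matrix.mul_assoc, hU, Matrix.mul_one]
  have e2 : Matrix.trace ((U * Z * Wᴴ)ᴴ * (W * Matrix.diagonal (fun i => (b i : ℂ)) * Wᴴ))
      = Matrix.trace (Zᴴ * ((Uᴴ * W) * Matrix.diagonal (fun i => (b i : ℂ)))) := by
    simp only [Matrix.conjTranspose_mul, Matrix.conjTranspose_conjTranspose, Matrix.mul_assoc]
    rw [Matrix.trace_mul_comm W]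
    simp only [Matrix.mul_assoc, hW, Matrix.mul_one]
  have e3 : Matrix.trace ((U * Z * Wᴴ)ᴴ * (U * Z * Wᴴ) *
      (W * Matrix.diagonal (fun i => (b i : ℂ)) * Wᴴ))
      = Matrix.trace (Zᴴ * (Z * Matrix.diagonal (fun i => (b i : ℂ)))) := by
    simp only [Matrix.conjTranspose_mul, Matrix.conjTranspose_conjTranspose, Matrix.mul_assoc]
    rw [Matrix.trace_mul_comm W]
    simp only [Matrix.mul_assoc, hW, Matrix.mul_one]
    rw [← Matrix.mul_assoc Wᴴ, hW, Matrix.one_mul, ← Matrix.mul_assoc Uᴴ, hU, Matrix.one_mul]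
  have e4 : Matrix.trace ((U * Z * Wᴴ)ᴴ * (U * Matrix.diagonal (fun i => (a i : ℂ)) * Uᴴ) *
      (U * Z * Wᴴ)) = Matrix.trace (Zᴴ * (Matrix.diagonal (fun i => (a i : ℂ)) * Z)) := by
    simp only [Matrix.conjTranspose_mul, Matrix.conjTranspose_conjTranspose, Matrix.mul_assoc]
    rw [Matrix.trace_mul_comm W]
    simp only [Matrix.mul_assoc, hW, Matrix.mul_one]
    rw [← Matrix.mul_assoc Uᴴ U, hU, Matrix.one_mul, ← Matrix.mul_assoc Uᴴ U, hU, Matrix.one_mul]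
  have tr : ∀ T : Matrix m m ℂ, (Matrix.trace (Zᴴ * T)).re
      = ∑ i, ∑ j, (star (Z i j) * T i j).re := by
    intro T
    rw [Finset.sum_comm]
    simp only [Matrix.trace, Matrix.diag, Matrix.mul_apply, Matrix.conjTranspose_apply,
      Complex.re_sum]
  unfold affineForm
  rw [Matrix.mul_sub, Matrix.trace_sub, e1, e2, e3, e4, Complex.sub_re, tr, tr, tr, tr]
  simp only [Finset.mul_sum, ← Finset.sum_sub_distrib, Matrix.diagonal_mul, Matrix.mul_diagonal]
  refine Finset.sum_congr rfl fun i _ => Finset.sum_congr rfl fun j _ => ?_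
  generalize (Uᴴ * W) i j = c
  simp [Complex.normSq_apply]
  ring

/-- After decoupling, complete the square in each entry `z` of Y; the maximizer is `z = (a i - b j)
/ (b j + t * a i) * c`, with `c` the overlap `(Uᴴ * W) i j`. -/
theorem isGreatest_affineForm {t : ℝ} (ht : 0 ≤ t) {U W : Matrix m m ℂ} (hU : Uᴴ * U = 1)
    (hU' : U * Uᴴ = 1) (hW : Wᴴ * W = 1) {a b : m → ℝ} (ha : ∀ i, 0 ≤ a i) (hb : ∀ i, 0 < b i) :
    IsGreatest (Set.range fun Y => affineForm t Y
        (U * Matrix.diagonal (fun i => (a i : ℂ)) * Uᴴ)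
        (W * Matrix.diagonal (fun i => (b i : ℂ)) * Wᴴ))
      (∑ i, ∑ j, Complex.normSq ((Uᴴ * W) i j) * ((b j - a i) ^ 2 / (b j + t * a i))) := by
  have hpos : ∀ i j, 0 < b j + t * a i := fun i j =>
    add_pos_of_pos_of_nonneg (hb j) (mul_nonneg ht (ha i))
  constructor
  · refine ⟨U * Matrix.of (fun i j => (((a i - b j) / (b j + t * a i) : ℝ) : ℂ) * (Uᴴ * W) i j)
      * Wᴴ, ?_⟩
    dsimp only
    rw [affineForm_diagonal t hU hW]
    refine Finset.sum_congr rfl fun i _ => Finset.sum_congr rfl fun j _ => ?_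
    have := (hpos i j).ne'
    simp only [Matrix.of_apply]
    generalize (Uᴴ * W) i j = c
    have h : (star ((((a i - b j) / (b j + t * a i) : ℝ) : ℂ) * c) * c).re
        = (a i - b j) / (b j + t * a i) * Complex.normSq c := by
      rw [Complex.star_def, map_mul, Complex.conj_ofReal, mul_assoc, Complex.re_ofReal_mul,
        ← Complex.normSq_eq_conj_mul_self, Complex.ofReal_re]
    rw [h, Complex.normSq_mul, Complex.normSq_ofReal]
    field_simp
    ring
  · rintro _ ⟨Y, rfl⟩
    have hY : Y = U * (Uᴴ * Y * W) * Wᴴ := by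
      have hW' : W * Wᴴ = 1 := mul_eq_one_comm.mp hW
      simp only [← Matrix.mul_assoc, hU', Matrix.one_mul]
      rw [Matrix.mul_assoc, hW', Matrix.mul_one]
    dsimp only
    rw [hY, affineForm_diagonal t hU hW]
    refine Finset.sum_le_sum fun i _ => Finset.sum_le_sum fun j _ => ?_
    generalize (Uᴴ * W) i j = c
    generalize (Uᴴ * Y * W) i j = z
    rw [← mul_div_assoc, le_div_iff₀ (hpos i j)]
    simp only [Complex.normSq_apply, Complex.star_def, Complex.mul_re, Complex.conj_re,
      Complex.conj_im]
    nlinarith [sq_nonneg ((b j + t * a i) * z.re - (a i - b j) * c.re),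
      sq_nonneg ((b j + t * a i) * z.im - (a i - b j) * c.im)]

theorem quadDivergence_eq {t : ℝ} (ht : 0 ≤ t) {U W : Matrix m m ℂ} (hU : Uᴴ * U = 1)
    (hU' : U * Uᴴ = 1) (hW : Wᴴ * W = 1) {a b : m → ℝ} (ha : ∀ i, 0 ≤ a i) (hb : ∀ i, 0 < b i) :
    quadDivergence t (U * Matrix.diagonal (fun i => (a i : ℂ)) * Uᴴ)
        (W * Matrix.diagonal (fun i => (b i : ℂ)) * Wᴴ)
      = ∑ i, ∑ j, Complex.normSq ((Uᴴ * W) i j) * ((b j - a i) ^ 2 / (b j + t * a i)) :=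
  (isGreatest_affineForm ht hU hU' hW ha hb).csSup_eq

theorem isGreatest_quadDivergence {t : ℝ} (ht : 0 ≤ t) {A B : Matrix m m ℂ}
    (hA : A.PosSemidef) (hB : B.PosDef) :
    IsGreatest (Set.range fun Y => affineForm t Y A B) (quadDivergence t A B) := by
  obtain ⟨U, hU, hU', h1⟩ := exists_conj_diagonal hA.isHermitian
  obtain ⟨W, hW, -, h2⟩ := exists_conj_diagonal hB.isHermitian
  have h := isGreatest_affineForm ht hU hU' hW hA.eigenvalues_nonneg hB.eigenvalues_pos
  rw [← h1, ← h2] at h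
  rwa [quadDivergence, iSup, h.csSup_eq]

/-- A supremum of functions linear in the pair (A, B) is convex. -/
theorem quadDivergence_combo_le {t : ℝ} (ht : 0 ≤ t) {A₁ B₁ A₂ B₂ : Matrix m m ℂ}
    (hA₁ : A₁.PosSemidef) (hB₁ : B₁.PosDef) (hA₂ : A₂.PosSemidef) (hB₂ : B₂.PosDef) {x y : ℝ}
    (hx : 0 ≤ x) (hy : 0 ≤ y) :
    quadDivergence t (x • A₁ + y • A₂) (x • B₁ + y • B₂)
      ≤ x * quadDivergence t A₁ B₁ + y * quadDivergence t A₂ B₂ := by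
  refine ciSup_le fun Y => ?_
  rw [affineForm_combo]
  have h1 := (isGreatest_quadDivergence ht hA₁ hB₁).2 ⟨Y, rfl⟩
  have h2 := (isGreatest_quadDivergence ht hA₂ hB₂).2 ⟨Y, rfl⟩
  dsimp only at h1 h2
  gcongr

open MeasureTheory Set

/-- An integral form of the quantum relative entropy (for operators of equal trace). -/
def quantumDivergence (A B : Matrix m m ℂ) : ℝ :=
  ∫ t in Ioi (0 : ℝ), quadDivergence t A B / (1 + t) ^ 2

theorem integrableOn_and_quantumDivergence_eq_sum {U W : Matrix m m ℂ} (hU : Uᴴ * U = 1)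
    (hU' : U * Uᴴ = 1) (hW : Wᴴ * W = 1) {a b : m → ℝ} (ha : ∀ i, 0 ≤ a i) (hb : ∀ i, 0 < b i) :
    IntegrableOn (fun t => quadDivergence t (U * Matrix.diagonal (fun i => (a i : ℂ)) * Uᴴ)
        (W * Matrix.diagonal (fun i => (b i : ℂ)) * Wᴴ) / (1 + t) ^ 2) (Ioi 0) ∧
      quantumDivergence (U * Matrix.diagonal (fun i => (a i : ℂ)) * Uᴴ)
        (W * Matrix.diagonal (fun i => (b i : ℂ)) * Wᴴ)
      = ∑ i, ∑ j, Complex.normSq ((Uᴴ * W) i j)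
          * (a i * (Real.log (a i) - Real.log (b j)) - a i + b j) := by
  have he : ∀ t ∈ Ioi (0 : ℝ), quadDivergence t (U * Matrix.diagonal (fun i => (a i : ℂ)) * Uᴴ)
        (W * Matrix.diagonal (fun i => (b i : ℂ)) * Wᴴ) / (1 + t) ^ 2
      = ∑ i, ∑ j, Complex.normSq ((Uᴴ * W) i j)
          * ((b j - a i) ^ 2 / (b j + t * a i) / (1 + t) ^ 2) := by
    intro t ht
    rw [quadDivergence_eq (le_of_lt ht) hU hU' hW ha hb]
    simp only [Finset.sum_div, mul_div_assoc]
  have hi : ∀ i j, IntegrableOn (fun t => Complex.normSq ((Uᴴ * W) i j)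
      * ((b j - a i) ^ 2 / (b j + t * a i) / (1 + t) ^ 2)) (Ioi 0) := fun i j =>
    (integrableOn_divergence_and_integral (ha i) (hb j)).1.const_mul _
  constructor
  · rw [integrableOn_congr_fun he measurableSet_Ioi]
    exact integrable_finsetSum _ fun i _ => integrable_finsetSum _ fun j _ => hi i j
  · rw [quantumDivergence, setIntegral_congr_fun measurableSet_Ioi he,
      integral_finsetSum _ fun i _ => integrable_finsetSum _ fun j _ => hi i j]
    refine Finset.sum_congr rfl fun i _ => ?_
    rw [integral_finsetSum _ fun j _ => hi i j]
    refine Finset.sum_congr rfl fun j _ => ?_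
    rw [integral_const_mul, (integrableOn_divergence_and_integral (ha i) (hb j)).2]

theorem integrableOn_quadDivergence {A B : Matrix m m ℂ} (hA : A.PosSemidef) (hB : B.PosDef) :
    IntegrableOn (fun t => quadDivergence t A B / (1 + t) ^ 2) (Ioi 0) := by
  obtain ⟨U, hU, hU', h1⟩ := exists_conj_diagonal hA.isHermitian
  obtain ⟨W, hW, -, h2⟩ := exists_conj_diagonal hB.isHermitian
  have h := (integrableOn_and_quantumDivergence_eq_sum hU hU' hW hA.eigenvalues_nonneg hB.eigenvalues_pos).1
  rwa [← h1, ← h2] at h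

theorem quantumDivergence_combo_le {A₁ B₁ A₂ B₂ : Matrix m m ℂ}
    (hA₁ : A₁.PosSemidef) (hB₁ : B₁.PosDef) (hA₂ : A₂.PosSemidef) (hB₂ : B₂.PosDef) {x y : ℝ}
    (hx : 0 ≤ x) (hy : 0 ≤ y) (hA : (x • A₁ + y • A₂).PosSemidef)
    (hB : (x • B₁ + y • B₂).PosDef) :
    quantumDivergence (x • A₁ + y • A₂) (x • B₁ + y • B₂)
      ≤ x * quantumDivergence A₁ B₁ + y * quantumDivergence A₂ B₂ := by
  have i1 := integrableOn_quadDivergence hA₁ hB₁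
  have i2 := integrableOn_quadDivergence hA₂ hB₂
  unfold quantumDivergence
  rw [← integral_const_mul, ← integral_const_mul, ← integral_add (i1.const_mul x) (i2.const_mul y)]
  refine setIntegral_mono_on (integrableOn_quadDivergence hA hB)
    ((i1.const_mul x).add (i2.const_mul y)) measurableSet_Ioi fun t ht => ?_
  have := quadDivergence_combo_le (le_of_lt ht) hA₁ hB₁ hA₂ hB₂ hx hy
  rw [← mul_div_assoc, ← mul_div_assoc, ← add_div]
  gcongr

theorem sum_normSq_row {C : Matrix m m ℂ} (hC : C * Cᴴ = 1) (i : m) :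
    ∑ j, Complex.normSq (C i j) = 1 := by
  have h := congrFun (congrFun hC i) i
  have h' := congrArg Complex.re h
  simpa [Matrix.mul_apply, Complex.mul_conj, Complex.re_sum] using h'

/-- The squared overlaps `|(U† W)_{ij}|²` form a doubly stochastic matrix, and `hd` says that it
sends `a` to `b`. Hence the cross term `∑ a_i log b_j` collapses to `∑ b_j log b_j`, and the linear
terms cancel. -/
theorem quantumDivergence_eq {U W : Matrix m m ℂ} (hU : Uᴴ * U = 1)
    (hU' : U * Uᴴ = 1) (hW : Wᴴ * W = 1) {a b : m → ℝ} (ha : ∀ i, 0 ≤ a i) (hb : ∀ i, 0 < b i)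
    (hd : ∀ j, ((Wᴴ * (U * Matrix.diagonal (fun i => (a i : ℂ)) * Uᴴ) * W) j j).re = b j) :
    quantumDivergence (U * Matrix.diagonal (fun i => (a i : ℂ)) * Uᴴ)
        (W * Matrix.diagonal (fun i => (b i : ℂ)) * Wᴴ)
      = ∑ i, a i * Real.log (a i) - ∑ j, b j * Real.log (b j) := by
  have hW' : W * Wᴴ = 1 := mul_eq_one_comm.mp hW
  have hC : (Uᴴ * W) * (Uᴴ * W)ᴴ = 1 := by
    rw [Matrix.conjTranspose_mul, Matrix.conjTranspose_conjTranspose, Matrix.mul_assoc,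
      ← Matrix.mul_assoc W, hW', Matrix.one_mul, hU]
  have row := sum_normSq_row hC
  have col : ∀ j, ∑ i, Complex.normSq ((Uᴴ * W) i j) = 1 := by
    intro j
    have := sum_normSq_row (C := (Uᴴ * W)ᴴ)
      (by rw [Matrix.conjTranspose_conjTranspose]; exact mul_eq_one_comm.mp hC) j
    simpa [Matrix.conjTranspose_apply] using this
  have hb' : ∀ j, ∑ i, Complex.normSq ((Uᴴ * W) i j) * a i = b j := by
    intro j
    rw [← hd j]
    have : Wᴴ * (U * Matrix.diagonal (fun i => (a i : ℂ)) * Uᴴ) * W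
        = (Uᴴ * W)ᴴ * Matrix.diagonal (fun i => (a i : ℂ)) * (Uᴴ * W) := by
      simp only [Matrix.conjTranspose_mul, Matrix.conjTranspose_conjTranspose, Matrix.mul_assoc]
    rw [this, Matrix.mul_apply, Complex.re_sum]
    refine Finset.sum_congr rfl fun i _ => ?_
    rw [Matrix.mul_diagonal, Matrix.conjTranspose_apply]
    simp [Complex.normSq_apply]
    ring
  rw [(integrableOn_and_quantumDivergence_eq_sum hU hU' hW ha hb).2]
  have key : ∀ i j, Complex.normSq ((Uᴴ * W) i j)
      * (a i * (Real.log (a i) - Real.log (b j)) - a i + b j)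
      = Complex.normSq ((Uᴴ * W) i j) * (a i * Real.log (a i) - a i)
        + Complex.normSq ((Uᴴ * W) i j) * b j
        - Complex.normSq ((Uᴴ * W) i j) * a i * Real.log (b j) := fun i j => by ring
  simp only [key, Finset.sum_add_distrib, Finset.sum_sub_distrib]
  rw [Finset.sum_comm (f := fun i j => Complex.normSq ((Uᴴ * W) i j) * b j),
    Finset.sum_comm (f := fun i j => Complex.normSq ((Uᴴ * W) i j) * a i * Real.log (b j))]
  simp only [← Finset.sum_mul, row, col, hb', one_mul]
  have hs : ∑ i, a i = ∑ j, b j := by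
    simp only [← hb']
    rw [Finset.sum_comm]
    simp only [← Finset.sum_mul, row, one_mul]
  rw [Finset.sum_sub_distrib, hs]
  ring

end JointConvexity

/-! ### Entropy gain under pinching -/

section Pinching

variable {m S : Type*} [Fintype m] [DecidableEq m] [Fintype S] [DecidableEq S]

/-- The `s`-th diagonal block of a matrix on `ℂᵐ ⊗ ℂˢ`. -/
def diagBlock (T : Matrix (m × S) (m × S) ℂ) (s : S) : Matrix m m ℂ :=
  T.submatrix (fun i => (i, s)) (fun i => (i, s))

/-- The entropy gain `H(pinching T) - H(T)` under the pinching to the diagonal blocks. -/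
def pinchingGain (T : Matrix (m × S) (m × S) ℂ) : ℝ :=
  ∑ s, vnEntropy (diagBlock T s) - vnEntropy T

omit [DecidableEq m] in
theorem diagBlock_conj_blockDiagonal (V : S → Matrix m m ℂ) (T : Matrix (m × S) (m × S) ℂ)
    (s : S) : diagBlock ((Matrix.blockDiagonal V)ᴴ * T * Matrix.blockDiagonal V) s
      = (V s)ᴴ * diagBlock T s * V s := by
  ext i j
  simp [diagBlock, Matrix.mul_apply, Matrix.blockDiagonal_apply, Fintype.sum_prod_type,
    apply_ite, ite_mul]

omit [Fintype m] [DecidableEq m] [Fintype S] [DecidableEq S] in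
theorem posDef_diagBlock {T : Matrix (m × S) (m × S) ℂ} (hT : T.PosDef) (s : S) :
    (diagBlock T s).PosDef :=
  hT.submatrix (Prod.mk_left_injective s)

omit [Fintype m] [DecidableEq m] [Fintype S] in
theorem blockDiagonal_diagBlock_combo (T₁ T₂ : Matrix (m × S) (m × S) ℂ) (x y : ℝ) :
    Matrix.blockDiagonal (diagBlock (x • T₁ + y • T₂))
      = x • Matrix.blockDiagonal (diagBlock T₁) + y • Matrix.blockDiagonal (diagBlock T₂) := by
  rw [← Matrix.blockDiagonal_smul, ← Matrix.blockDiagonal_smul, ← Matrix.blockDiagonal_add]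
  rfl

/-- Diagonalize block by block. As W is block diagonal, the diagonal of `W† T W` sees only the
diagonal blocks of T; this supplies hypothesis `hd` of `quantumDivergence_eq`. -/
theorem exists_blockDiagonal_eigenbasis {T : Matrix (m × S) (m × S) ℂ} (hT : T.PosDef) :
    ∃ (W : Matrix (m × S) (m × S) ℂ) (b : m × S → ℝ), Wᴴ * W = 1 ∧ (∀ k, 0 < b k) ∧
      Matrix.blockDiagonal (diagBlock T) = W * Matrix.diagonal (fun k => (b k : ℂ)) * Wᴴ ∧
      (∀ k, ((Wᴴ * T * W) k k).re = b k) ∧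
      ∀ s, vnEntropy (diagBlock T s) = ∑ i, etaTwo (b (i, s)) := by
  have hb := posDef_diagBlock hT
  choose V hV hV' hVd using fun s => exists_conj_diagonal (hb s).isHermitian
  refine ⟨Matrix.blockDiagonal V, fun k => (hb k.2).isHermitian.eigenvalues k.1, ?_,
    fun k => (hb k.2).eigenvalues_pos k.1, ?_, ?_, fun s => vnEntropy_eq_sum_eigenvalues (hb s).isHermitian⟩
  · rw [Matrix.blockDiagonal_conjTranspose, ← Matrix.blockDiagonal_mul,
      ← Matrix.blockDiagonal_one]
    congr 1
    funext s
    exact hV s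
  · have hd : Matrix.diagonal (fun k : m × S => ((hb k.2).isHermitian.eigenvalues k.1 : ℂ))
        = Matrix.blockDiagonal fun s =>
            Matrix.diagonal fun i => ((hb s).isHermitian.eigenvalues i : ℂ) :=
      (Matrix.blockDiagonal_diagonal
        fun s i => ((hb s).isHermitian.eigenvalues i : ℂ)).symm
    rw [hd, Matrix.blockDiagonal_conjTranspose, ← Matrix.blockDiagonal_mul,
      ← Matrix.blockDiagonal_mul]
    congr 1
    funext s
    exact hVd s
  · rintro ⟨i, s⟩
    have h := congrFun (congrFun (diagBlock_conj_blockDiagonal V T s) i) i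
    have h2 : (V s)ᴴ * diagBlock T s * V s
        = Matrix.diagonal (fun i => ((hb s).isHermitian.eigenvalues i : ℂ)) := by
      conv_lhs => rw [hVd s]
      rw [Matrix.mul_assoc, Matrix.mul_assoc, Matrix.mul_assoc, hV, Matrix.mul_one,
        ← Matrix.mul_assoc, hV, Matrix.one_mul]
    rw [h2] at h
    change ((diagBlock ((Matrix.blockDiagonal V)ᴴ * T * Matrix.blockDiagonal V) s) i i).re = _
    rw [h]
    simp

theorem posDef_blockDiagonal_diagBlock {T : Matrix (m × S) (m × S) ℂ} (hT : T.PosDef) :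
    (Matrix.blockDiagonal (diagBlock T)).PosDef := by
  obtain ⟨W, b, hW, hb, h, -, -⟩ := exists_blockDiagonal_eigenbasis hT
  rw [h]
  refine Matrix.PosDef.mul_mul_conjTranspose_same
    (Matrix.PosDef.diagonal fun k => by exact_mod_cast hb k) ?_
  intro x y hxy
  have hW' : W * Wᴴ = 1 := mul_eq_one_comm.mp hW
  have := congrArg (fun v => Matrix.vecMul v Wᴴ) hxy
  simpa [Matrix.vecMul_vecMul, hW'] using this

theorem pinchingGain_eq {T : Matrix (m × S) (m × S) ℂ} (hT : T.PosDef) :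
    pinchingGain T
      = quantumDivergence T (Matrix.blockDiagonal (diagBlock T)) / Real.log 2 := by
  obtain ⟨W, b, hW, hb, h, hd, hs⟩ := exists_blockDiagonal_eigenbasis hT
  obtain ⟨U, hU, hU', hT'⟩ := exists_conj_diagonal hT.isHermitian
  have hq : quantumDivergence T (Matrix.blockDiagonal (diagBlock T))
      = ∑ i, hT.isHermitian.eigenvalues i * Real.log (hT.isHermitian.eigenvalues i)
        - ∑ j, b j * Real.log (b j) := by
    have := quantumDivergence_eq hU hU' hW (fun i => (hT.eigenvalues_pos i).le) hb
      (by rw [← hT']; exact hd)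
    rwa [← hT', ← h] at this
  rw [hq, pinchingGain, vnEntropy_eq_sum_eigenvalues hT.isHermitian]
  simp only [hs]
  rw [← Fintype.sum_prod_type_right (fun k => etaTwo (b k))]
  simp only [etaTwo, Real.logb, Finset.sum_neg_distrib, sub_div, Finset.sum_div, mul_div_assoc]
  ring

theorem pinchingGain_combo_le_of_posDef {T₁ T₂ : Matrix (m × S) (m × S) ℂ} (h₁ : T₁.PosDef)
    (h₂ : T₂.PosDef) {x y : ℝ} (hx : 0 ≤ x) (hy : 0 ≤ y) (h : (x • T₁ + y • T₂).PosDef) :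
    pinchingGain (x • T₁ + y • T₂) ≤ x * pinchingGain T₁ + y * pinchingGain T₂ := by
  have hb := posDef_blockDiagonal_diagBlock h
  rw [pinchingGain_eq h₁, pinchingGain_eq h₂, pinchingGain_eq h, ← mul_div_assoc,
    ← mul_div_assoc, ← add_div]
  rw [blockDiagonal_diagBlock_combo] at hb ⊢
  have := quantumDivergence_combo_le h₁.posSemidef (posDef_blockDiagonal_diagBlock h₁)
    h₂.posSemidef (posDef_blockDiagonal_diagBlock h₂) hx hy h.posSemidef hb
  have h2 : 0 < Real.log 2 := Real.log_pos one_lt_two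
  gcongr

theorem continuousOn_pinchingGain :
    ContinuousOn (pinchingGain : Matrix (m × S) (m × S) ℂ → ℝ) {T | T.IsHermitian} := by
  unfold pinchingGain
  refine (continuousOn_finsetSum _ fun s _ => ?_).sub continuousOn_vnEntropy
  refine continuousOn_vnEntropy.comp ?_ fun T hT => hT.submatrix _
  exact (continuous_id.matrix_submatrix _ _).continuousOn

open Filter Topology in
theorem tendsto_pinchingGain {T : Matrix (m × S) (m × S) ℂ} (hT : T.IsHermitian) :
    Tendsto (fun ε : ℝ => pinchingGain (T + ε • 1)) (𝓝[>] 0) (𝓝 (pinchingGain T)) := by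
  have hc : Continuous fun ε : ℝ => T + ε • (1 : Matrix (m × S) (m × S) ℂ) := by fun_prop
  have h0 : Tendsto (fun ε : ℝ => T + ε • (1 : Matrix (m × S) (m × S) ℂ)) (𝓝[>] 0)
      (𝓝[{T | T.IsHermitian}] T) := by
    refine tendsto_nhdsWithin_iff.mpr ⟨?_, Eventually.of_forall fun ε => ?_⟩
    · have := (hc.tendsto 0).mono_left (nhdsWithin_le_nhds (s := Set.Ioi 0))
      simpa using this
    · exact hT.add (by simp [Matrix.IsHermitian, Matrix.conjTranspose_smul])
  exact (continuousOn_pinchingGain T hT).tendsto.comp h0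

-- The integral formula needs positive definite arguments. Replace `T_i` by `T_i + ε`, which is
-- compatible with the combination because `x + y = 1`, and let `ε → 0` by continuity.
open Filter Topology in
theorem pinchingGain_combo_le {T₁ T₂ : Matrix (m × S) (m × S) ℂ} (h₁ : T₁.PosSemidef)
    (h₂ : T₂.PosSemidef) {x y : ℝ} (hx : 0 ≤ x) (hy : 0 ≤ y) (hxy : x + y = 1) :
    pinchingGain (x • T₁ + y • T₂) ≤ x * pinchingGain T₁ + y * pinchingGain T₂ := by
  have h : (x • T₁ + y • T₂).PosSemidef := (h₁.smul hx).add (h₂.smul hy)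
  refine le_of_tendsto_of_tendsto (tendsto_pinchingGain h.isHermitian)
    (((tendsto_pinchingGain h₁.isHermitian).const_mul x).add
      ((tendsto_pinchingGain h₂.isHermitian).const_mul y)) ?_
  filter_upwards [self_mem_nhdsWithin] with ε hε
  have h1 : (ε • (1 : Matrix (m × S) (m × S) ℂ)).PosDef := Matrix.PosDef.one.smul hε
  have he : x • T₁ + y • T₂ + ε • (1 : Matrix (m × S) (m × S) ℂ)
      = x • (T₁ + ε • 1) + y • (T₂ + ε • 1) := by
    rw [smul_add, smul_add, add_add_add_comm, ← add_smul, hxy, one_smul]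
  have hp := Matrix.PosDef.posSemidef_add h h1
  rw [he] at hp ⊢
  exact pinchingGain_combo_le_of_posDef (Matrix.PosDef.posSemidef_add h₁ h1)
    (Matrix.PosDef.posSemidef_add h₂ h1) hx hy hp

end Pinching

/-! ### Convexity, continuity and homogeneity of W -/

section CondEntropy

variable {n S P : Type*} [Fintype n] [DecidableEq n] [Fintype S] [Fintype P]

theorem isHermitian_cfc_sqrt (E : Matrix n n ℂ) : (cfc Real.sqrt E)ᴴ = cfc Real.sqrt E :=
  cfc_predicate Real.sqrt E

theorem cfc_sqrt_mul_cfc_sqrt {E : Matrix n n ℂ} (hE : E.PosSemidef) :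
    (cfc Real.sqrt E)ᴴ * cfc Real.sqrt E = E := by
  rw [isHermitian_cfc_sqrt, ← cfc_mul Real.sqrt Real.sqrt E]
  have hs : Set.EqOn (fun t => √t * √t) id (spectrum ℝ E) := by
    intro t ht
    rw [hE.isHermitian.spectrum_real_eq_range_eigenvalues] at ht
    obtain ⟨i, rfl⟩ := ht
    exact Real.mul_self_sqrt (hE.eigenvalues_nonneg i)
  rw [cfc_congr hs]
  exact cfc_id ℝ E hE.isHermitian

/-- The column of the operators `√N_{sp}`, `s ∈ S`. -/
def krausColumn (N : S × P → Matrix n n ℂ) (p : P) : Matrix (n × S) n ℂ :=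
  Matrix.of fun k j => cfc Real.sqrt (N (k.2, p)) k.1 j

omit [Fintype P] in
theorem krausColumn_conjTranspose_mul {N : S × P → Matrix n n ℂ}
    (hN : ∀ k, (N k).PosSemidef) (p : P) :
    (krausColumn N p)ᴴ * krausColumn N p = ∑ s, N (s, p) := by
  have : ∀ s, N (s, p) = (cfc Real.sqrt (N (s, p)))ᴴ * cfc Real.sqrt (N (s, p)) := fun s =>
    (cfc_sqrt_mul_cfc_sqrt (hN _)).symm
  rw [Finset.sum_congr rfl fun s _ => this s]
  ext i j
  rw [Matrix.mul_apply, Fintype.sum_prod_type_right, Matrix.sum_apply]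
  simp [krausColumn, Matrix.mul_apply]

omit [Fintype S] [Fintype P] in
theorem diagBlock_krausColumn [DecidableEq S] (N : S × P → Matrix n n ℂ) (p : P)
    (ρ : Matrix n n ℂ) (s : S) :
    diagBlock (krausColumn N p * ρ * (krausColumn N p)ᴴ) s = sqrtConj (N (s, p)) ρ := by
  ext i j
  simp [diagBlock, krausColumn, sqrtConj, Matrix.mul_apply]

/-- The column V satisfies `V† V = M_p`, so V may replace `√M_p` inside the entropy without changing
it, while the blocks of `V ρ V†` give the terms for the pairs `(s, p)`. -/
theorem condEntropyFun_eq [DecidableEq S] {N : S × P → Matrix n n ℂ}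
    (hN : ∀ k, (N k).PosSemidef) {ρ : Matrix n n ℂ} (hρ : ρ.PosSemidef) :
    condEntropyFun N ρ
      = ∑ p, pinchingGain (krausColumn N p * ρ * (krausColumn N p)ᴴ) := by
  unfold condEntropyFun pinchingGain
  rw [Finset.sum_comm, ← Finset.sum_sub_distrib]
  refine Finset.sum_congr rfl fun p _ => ?_
  simp only [diagBlock_krausColumn]
  congr 1
  refine vnEntropy_conj_congr ?_ hρ
  rw [krausColumn_conjTranspose_mul hN,
    cfc_sqrt_mul_cfc_sqrt (Matrix.posSemidef_sum _ fun s _ => hN (s, p))]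

/-- The conditional entropy function is convex on positive semidefinite operators. -/
theorem convexOn_condEntropyFun {N : S × P → Matrix n n ℂ} (hN : ∀ k, (N k).PosSemidef) :
    ConvexOn ℝ {ρ : Matrix n n ℂ | ρ.PosSemidef} (condEntropyFun N) := by
  classical
  refine ⟨fun ρ hρ σ hσ x y hx hy _ => (hρ.smul hx).add (hσ.smul hy),
    fun ρ hρ σ hσ x y hx hy hxy => ?_⟩
  have h : (x • ρ + y • σ).PosSemidef := (hρ.smul hx).add (hσ.smul hy)
  rw [condEntropyFun_eq hN hρ, condEntropyFun_eq hN hσ, condEntropyFun_eq hN h, smul_eq_mul,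
    smul_eq_mul, Finset.mul_sum, Finset.mul_sum, ← Finset.sum_add_distrib]
  refine Finset.sum_le_sum fun p _ => ?_
  rw [Matrix.mul_add, Matrix.add_mul, Matrix.mul_smul, Matrix.mul_smul, Matrix.smul_mul,
    Matrix.smul_mul]
  exact pinchingGain_combo_le (hρ.mul_mul_conjTranspose_same _)
    (hσ.mul_mul_conjTranspose_same _) hx hy hxy

theorem isHermitian_sqrtConj (E : Matrix n n ℂ) {ρ : Matrix n n ℂ} (hρ : ρ.IsHermitian) :
    (sqrtConj E ρ).IsHermitian :=
  Matrix.isHermitian_mul_mul_conjTranspose _ hρ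

theorem continuousOn_condEntropyFun (N : S × P → Matrix n n ℂ) :
    ContinuousOn (condEntropyFun N) {ρ : Matrix n n ℂ | ρ.IsHermitian} := by
  have h : ∀ E : Matrix n n ℂ, ContinuousOn (fun ρ => vnEntropy (sqrtConj E ρ))
      {ρ : Matrix n n ℂ | ρ.IsHermitian} := fun E =>
    continuousOn_vnEntropy.comp (by unfold sqrtConj; fun_prop)
      fun ρ hρ => isHermitian_sqrtConj E hρ
  unfold condEntropyFun
  exact (continuousOn_finsetSum _ fun s _ => continuousOn_finsetSum _ fun p _ => h _).sub
    (continuousOn_finsetSum _ fun p _ => h _)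

theorem vnEntropy_zero : vnEntropy (0 : Matrix n n ℂ) = 0 := by
  simp [vnEntropy, cfc_apply_zero]

theorem condEntropyFun_zero (N : S × P → Matrix n n ℂ) : condEntropyFun N 0 = 0 := by
  simp [condEntropyFun, sqrtConj, vnEntropy_zero]

theorem sqrtConj_smul (E ρ : Matrix n n ℂ) (s : ℝ) : sqrtConj E (s • ρ) = s • sqrtConj E ρ := by
  simp [sqrtConj]

theorem trace_sqrtConj {E : Matrix n n ℂ} (hE : E.PosSemidef) (ρ : Matrix n n ℂ) :
    (sqrtConj E ρ).trace = (ρ * E).trace := by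
  rw [sqrtConj, Matrix.mul_assoc, Matrix.trace_mul_comm, Matrix.mul_assoc,
    cfc_sqrt_mul_cfc_sqrt hE]

theorem condEntropyFun_smul {N : S × P → Matrix n n ℂ} (hN : ∀ k, (N k).PosSemidef)
    {ρ : Matrix n n ℂ} (hρ : ρ.IsHermitian) (s : ℝ) :
    condEntropyFun N (s • ρ) = s * condEntropyFun N ρ := by
  rcases eq_or_ne s 0 with rfl | hs
  · simp [condEntropyFun_zero]
  have hM : ∀ p, (∑ s, N (s, p)).PosSemidef := fun p =>
    Matrix.posSemidef_sum _ fun s _ => hN (s, p)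
  have h : ∀ E : Matrix n n ℂ, E.PosSemidef → vnEntropy (sqrtConj E (s • ρ))
      = s * vnEntropy (sqrtConj E ρ) + etaTwo s * ((ρ * E).trace).re := fun E hE => by
    rw [sqrtConj_smul, vnEntropy_smul (isHermitian_sqrtConj E hρ) hs, trace_sqrtConj hE]
  have ht : ∑ s, ∑ p, ((ρ * N (s, p)).trace).re = ∑ p, ((ρ * ∑ s, N (s, p)).trace).re := by
    rw [Finset.sum_comm]
    refine Finset.sum_congr rfl fun p _ => ?_
    rw [Matrix.mul_sum, Matrix.trace_sum, Complex.re_sum]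
  unfold condEntropyFun
  rw [Finset.sum_congr rfl fun i _ => Finset.sum_congr rfl fun p _ => h _ (hN (i, p)),
    Finset.sum_congr rfl fun p _ => h _ (hM p)]
  simp only [Finset.sum_add_distrib, ← Finset.mul_sum]
  rw [ht]
  ring

end CondEntropy

/-! ### Compactness of the set of states -/

section States

variable {n : Type*} [Fintype n] [DecidableEq n]

theorem convex_densityOperators : Convex ℝ (densityOperators n) := by
  intro ρ hρ σ hσ x y hx hy hxy
  refine ⟨(hρ.1.smul hx).add (hσ.1.smul hy), ?_⟩
  rw [Matrix.trace_add, Matrix.trace_smul, Matrix.trace_smul, hρ.2, hσ.2]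
  simp only [Complex.real_smul, mul_one]
  exact_mod_cast hxy

theorem isClosed_densityOperators : IsClosed (densityOperators n) := by
  have h : densityOperators n = {ρ | ρ.IsHermitian} ∩
      ((⋂ x : n → ℂ, {ρ : Matrix n n ℂ | 0 ≤ star x ⬝ᵥ (ρ *ᵥ x)}) ∩ {ρ | ρ.trace = 1}) := by
    ext ρ
    simp [densityOperators, Matrix.posSemidef_iff_dotProduct_mulVec, and_assoc]
  rw [h]
  refine (isClosed_eq (by fun_prop) continuous_id).inter ((isClosed_iInter fun x => ?_).inter
    (isClosed_eq (by fun_prop) continuous_const))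
  exact isClosed_le continuous_const (by fun_prop)

/-- Boundedness: with `ρ = B† B`, each entry satisfies `|ρ_ij| ≤ (ρ_ii + ρ_jj) / 2 ≤ 1`. -/
theorem isCompact_densityOperators : IsCompact (densityOperators n) := by
  have hK : IsCompact (Set.univ.pi fun _ : n => Set.univ.pi fun _ : n =>
      Metric.closedBall (0 : ℂ) 1) :=
    isCompact_univ_pi fun _ => isCompact_univ_pi fun _ => isCompact_closedBall 0 1
  refine hK.of_isClosed_subset isClosed_densityOperators fun ρ hρ i _ j _ => ?_
  obtain ⟨B, hB⟩ := exists_conjTranspose_mul_self hρ.1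
  have hd : ∀ i, (ρ i i).re = ∑ k, ‖B k i‖ ^ 2 := fun i => by
    rw [hB, Matrix.mul_apply, Complex.re_sum]
    refine Finset.sum_congr rfl fun k _ => ?_
    rw [Matrix.conjTranspose_apply, Complex.star_def, ← Complex.normSq_eq_conj_mul_self,
      Complex.ofReal_re, Complex.normSq_eq_norm_sq]
  have hd1 : ∀ i, (ρ i i).re ≤ 1 := fun i => by
    have h1 : ∑ i, (ρ i i).re = 1 := by
      have := congrArg Complex.re hρ.2
      simpa only [Matrix.trace, Matrix.diag, Complex.re_sum, Complex.one_re] using this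
    rw [← h1]
    refine Finset.single_le_sum (f := fun i => (ρ i i).re) (fun k _ => ?_) (Finset.mem_univ i)
    rw [hd]
    positivity
  rw [mem_closedBall_zero_iff]
  calc ‖ρ i j‖ ≤ ∑ k, ‖B k i‖ * ‖B k j‖ := by
        rw [hB, Matrix.mul_apply]
        refine (norm_sum_le _ _).trans (le_of_eq (Finset.sum_congr rfl fun k _ => ?_))
        rw [norm_mul, Matrix.conjTranspose_apply, norm_star]
    _ ≤ ∑ k, (‖B k i‖ ^ 2 + ‖B k j‖ ^ 2) / 2 :=
        Finset.sum_le_sum fun k _ => by linarith [two_mul_le_add_sq ‖B k i‖ ‖B k j‖]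
    _ = ((ρ i i).re + (ρ j j).re) / 2 := by
        rw [hd, hd, ← Finset.sum_add_distrib, Finset.sum_div]
    _ ≤ 1 := by linarith [hd1 i, hd1 j]

end States

/-! ### The scalar conjugate pair -/

section ScalarDuality

/-- Cauchy–Schwarz for `(a / c₁, k)`, a vector of length `c₀`, against `(c₁ s, 1)`. -/
theorem linear_add_sqrt_le {c₀ c₁ a s : ℝ} (hc₀ : 0 ≤ c₀) (hc₁ : 0 < c₁)
    (ha : |a| ≤ c₀ * c₁) :
    a * s + √(c₀ ^ 2 - a ^ 2 / c₁ ^ 2) ≤ c₀ * √(1 + c₁ ^ 2 * s ^ 2) := by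
  have h0 : 0 ≤ c₀ ^ 2 - a ^ 2 / c₁ ^ 2 := by
    rw [sub_nonneg, div_le_iff₀ (by positivity), ← mul_pow]
    exact sq_le_sq' (neg_le_of_abs_le ha) (le_of_abs_le ha)
  set k := √(c₀ ^ 2 - a ^ 2 / c₁ ^ 2) with hk
  have hk2 : k ^ 2 = c₀ ^ 2 - a ^ 2 / c₁ ^ 2 := Real.sq_sqrt h0
  rw [← Real.sqrt_sq hc₀, ← Real.sqrt_mul (sq_nonneg c₀)]
  apply Real.le_sqrt_of_sq_le
  obtain ⟨b, rfl⟩ : ∃ b, a = b * c₁ := ⟨a / c₁, by field_simp⟩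
  have hb : c₀ ^ 2 = k ^ 2 + b ^ 2 := by
    rw [hk2]
    field_simp
    ring
  rw [hb]
  nlinarith [sq_nonneg (k * (c₁ * s) - b)]

/-- The converse of `linear_add_sqrt_le`: the supremum over `s ≥ 0` reaches the penalty, and is
infinite for `a > c₀ c₁`. -/
theorem exists_linear_sub_gt {c₀ c₁ a r : ℝ} (hc₀ : 0 ≤ c₀) (hc₁ : 0 < c₁) (ha : 0 ≤ a)
    (hr : a ≤ c₀ * c₁ → r < -√(c₀ ^ 2 - a ^ 2 / c₁ ^ 2)) :
    ∃ s, 0 ≤ s ∧ r < a * s - c₀ * √(1 + c₁ ^ 2 * s ^ 2) := by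
  have hsq : ∀ s, 0 ≤ s → √(1 + c₁ ^ 2 * s ^ 2) ≤ 1 + c₁ * s := by
    intro s hs
    rw [Real.sqrt_le_left (by positivity)]
    nlinarith [mul_nonneg hc₁.le hs]
  rcases lt_trichotomy a (c₀ * c₁) with h | h | h
  · have hk0 : 0 < c₀ ^ 2 - a ^ 2 / c₁ ^ 2 := by
      rw [sub_pos, div_lt_iff₀ (by positivity), ← mul_pow]
      exact pow_lt_pow_left₀ h ha two_ne_zero
    have hr' := hr h.le
    set k := √(c₀ ^ 2 - a ^ 2 / c₁ ^ 2) with hk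
    have hk2 : k ^ 2 = c₀ ^ 2 - a ^ 2 / c₁ ^ 2 := Real.sq_sqrt hk0.le
    have hkp : 0 < k := Real.sqrt_pos.mpr hk0
    -- The critical point in `s`, i.e. equality in Cauchy–Schwarz.
    refine ⟨a / (c₁ ^ 2 * k), by positivity, ?_⟩
    have h1 : 1 + c₁ ^ 2 * (a / (c₁ ^ 2 * k)) ^ 2 = (c₀ / k) ^ 2 := by
      have : c₀ ^ 2 = k ^ 2 + a ^ 2 / c₁ ^ 2 := by rw [hk2]; ring
      rw [div_pow c₀, this]
      field_simp
    rw [h1, Real.sqrt_sq (by positivity)]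
    have h2 : a * (a / (c₁ ^ 2 * k)) - c₀ * (c₀ / k) = -k := by
      have : c₀ * (c₀ / k) = (k ^ 2 + a ^ 2 / c₁ ^ 2) / k := by
        rw [hk2]
        ring
      rw [this]
      field_simp
      ring
    rwa [h2]
  · have hr' := hr h.le
    have h0 : c₀ ^ 2 - a ^ 2 / c₁ ^ 2 = 0 := by
      rw [h]
      field_simp
      ring
    rw [h0, Real.sqrt_zero, neg_zero] at hr'
    -- On the boundary the value 0 is approached as `s → ∞`: with `u = c₁ s`, `√(1 + u²) ≤ u + 1 /
    -- u` leaves a gap of at most `c₀ / u`, and this `s` makes it less than `-r`.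
    have hs : 0 < (c₀ + 1) / (c₁ * -r) := by
      have : 0 < -r := by linarith
      positivity
    refine ⟨(c₀ + 1) / (c₁ * -r), hs.le, ?_⟩
    set u := c₁ * ((c₀ + 1) / (c₁ * -r)) with hu
    have hu1 : u * -r = c₀ + 1 := by
      rw [hu]
      have : r ≠ 0 := hr'.ne
      field_simp
    have hup : 0 < u := mul_pos hc₁ hs
    have h2 : √(1 + c₁ ^ 2 * ((c₀ + 1) / (c₁ * -r)) ^ 2) ≤ u + 1 / u := by
      rw [← mul_pow, ← hu, Real.sqrt_le_left (by positivity)]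
      have : (u + 1 / u) ^ 2 = u ^ 2 + 2 + (1 / u) ^ 2 := by
        field_simp
        ring
      rw [this]
      nlinarith [sq_nonneg (1 / u)]
    have h3 : a * ((c₀ + 1) / (c₁ * -r)) = c₀ * u := by rw [h, hu]; ring
    rw [h3]
    have h4 : c₀ * (1 / u) < -r := by
      rw [mul_one_div, div_lt_iff₀ hup]
      linarith
    nlinarith [mul_le_mul_of_nonneg_left h2 hc₀]
  · have hd : 0 < a - c₀ * c₁ := sub_pos.mpr h
    -- Beyond the boundary the expression is at least `(a - c₀ c₁) s - c₀`, which here equals `|r| +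
    -- 1`.
    refine ⟨(|r| + c₀ + 1) / (a - c₀ * c₁), by positivity, ?_⟩
    set s := (|r| + c₀ + 1) / (a - c₀ * c₁) with hs
    have hs0 : 0 ≤ s := by positivity
    have h1 : (a - c₀ * c₁) * s = |r| + c₀ + 1 := by
      rw [hs]
      field_simp
    nlinarith [mul_le_mul_of_nonneg_left (hsq s hs0) hc₀, le_abs_self r]

theorem convexOn_sqrt_one_add_sq (c : ℝ) :
    ConvexOn ℝ Set.univ fun s : ℝ => √(1 + c ^ 2 * s ^ 2) := by
  refine ⟨convex_univ, fun s _ t _ x y hx hy hxy => ?_⟩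
  have h : 1 + c ^ 2 * (s * t) ≤ √(1 + c ^ 2 * s ^ 2) * √(1 + c ^ 2 * t ^ 2) := by
    rw [← Real.sqrt_mul (by positivity)]
    apply Real.le_sqrt_of_sq_le
    nlinarith [mul_nonneg (sq_nonneg c) (sq_nonneg (s - t))]
  have hs := Real.sq_sqrt (show 0 ≤ 1 + c ^ 2 * s ^ 2 by positivity)
  have ht := Real.sq_sqrt (show 0 ≤ 1 + c ^ 2 * t ^ 2 by positivity)
  simp only [smul_eq_mul]
  rw [Real.sqrt_le_left (by positivity)]
  have e : 1 + c ^ 2 * (x * s + y * t) ^ 2 = x ^ 2 * (1 + c ^ 2 * s ^ 2)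
      + y ^ 2 * (1 + c ^ 2 * t ^ 2) + 2 * (x * y) * (1 + c ^ 2 * (s * t)) := by
    linear_combination -(x + y + 1) * hxy
  rw [e, ← hs, ← ht, hs, ht]
  nlinarith [mul_le_mul_of_nonneg_left h (mul_nonneg hx hy)]

end ScalarDuality

/-! ### Pairing of the ℓ¹ norm with the spread -/

section Spread

variable {X : Type*} [Fintype X]

omit [Fintype X] in
theorem spread_le [Nonempty X] {v : X → ℝ} {s : ℝ} (h : ∀ i j, v i - v j ≤ s) : spread v ≤ s := by
  unfold spread
  rw [sub_le_iff_le_add]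
  refine ciSup_le fun i => ?_
  rw [← sub_le_iff_le_add']
  exact le_ciInf fun j => by linarith [h i j]

theorem spread_nonneg [Nonempty X] (v : X → ℝ) : 0 ≤ spread v :=
  sub_nonneg.mpr (ciInf_le_ciSup (Set.finite_range v).bddBelow (Set.finite_range v).bddAbove)

theorem spread_add_const [Nonempty X] (v : X → ℝ) (c : ℝ) : spread (fun x => v x + c) = spread v := by
  unfold spread
  rw [← ciSup_add (Set.finite_range v).bddAbove, ← ciInf_add (Set.finite_range v).bddBelow]
  ring

theorem exists_spread_eq [Nonempty X] (v : X → ℝ) : ∃ i j, spread v = v i - v j := by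
  obtain ⟨i, hi⟩ := exists_eq_ciSup_of_finite (f := v)
  obtain ⟨j, hj⟩ := exists_eq_ciInf_of_finite (f := v)
  exact ⟨i, j, by rw [spread, hi, hj]⟩

/-- As `l` sums to zero, `v` may be centred at its midrange, after which its sup norm is at most
half the spread. -/
theorem dotProduct_le_l1Norm_mul_spread {l : X → ℝ} (hl : ∑ x, l x = 0) (v : X → ℝ) :
    l ⬝ᵥ v ≤ l1Norm l / 2 * spread v := by
  set c := ((⨆ x, v x) + ⨅ x, v x) / 2 with hc
  have h1 : ∀ x, |v x - c| ≤ spread v / 2 := by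
    intro x
    have h1 := le_ciSup (Set.finite_range v).bddAbove x
    have h2 := ciInf_le (Set.finite_range v).bddBelow x
    rw [abs_le, spread]
    constructor <;> linarith
  have h2 : l ⬝ᵥ v = ∑ x, l x * (v x - c) := by
    simp only [dotProduct, mul_sub, Finset.sum_sub_distrib, ← Finset.sum_mul, hl, zero_mul,
      sub_zero]
  rw [h2, l1Norm, div_mul_eq_mul_div, mul_div_assoc, Finset.sum_mul]
  refine Finset.sum_le_sum fun x _ => ?_
  refine (le_abs_self _).trans ?_
  rw [abs_mul]
  exact mul_le_mul_of_nonneg_left (h1 x) (abs_nonneg _)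

theorem l1Norm_neg (l : X → ℝ) : l1Norm (-l) = l1Norm l := by simp [l1Norm]

theorem l1Norm_nonneg (l : X → ℝ) : 0 ≤ l1Norm l := Finset.sum_nonneg fun _ _ => abs_nonneg _

end Spread

/-! ### Conjugate of the penalty -/

section Conjugates

variable {X : Type*} [Fintype X]

theorem iInf_extendTop {V : Type*} (C : Set V) (φ : V → ℝ) :
    ⨅ x, extendTop C φ x = ⨅ x ∈ C, (φ x : EReal) := by
  refine iInf_congr fun x => ?_
  by_cases h : x ∈ C <;> simp [extendTop, h]

theorem iSup_extendBot {V : Type*} (C : Set V) (φ : V → ℝ) :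
    ⨆ x, extendBot C φ x = ⨆ x ∈ C, (φ x : EReal) := by
  refine iSup_congr fun x => ?_
  by_cases h : x ∈ C <;> simp [extendBot, h]

theorem fenchelG_of_mem {c₀ c₁ : ℝ} {q₀ l : X → ℝ} (h : ∑ x, (l - q₀) x = 0)
    (h' : l1Norm (l - q₀) / 2 ≤ c₀ * c₁) :
    fenchelG c₀ c₁ q₀ l
      = ((-√(c₀ ^ 2 - (l1Norm (l - q₀) / 2) ^ 2 / c₁ ^ 2) : ℝ) : EReal) := by
  have h0 : |l1Norm (l - q₀) / 2| ≤ c₀ * c₁ := by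
    rwa [abs_of_nonneg (div_nonneg (l1Norm_nonneg _) zero_le_two)]
  rw [fenchelG, penalty, if_pos h, sFun, extendTop]
  exact (if_pos h0).trans (by rw [sq_abs])

theorem fenchelG_of_not_mem {c₀ c₁ : ℝ} {q₀ l : X → ℝ}
    (h : ¬(∑ x, (l - q₀) x = 0 ∧ l1Norm (l - q₀) / 2 ≤ c₀ * c₁)) :
    fenchelG c₀ c₁ q₀ l = ⊤ := by
  rw [fenchelG, penalty]
  split_ifs with h1
  · have h0 : ¬|l1Norm (l - q₀) / 2| ≤ c₀ * c₁ := by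
      rw [abs_of_nonneg (div_nonneg (l1Norm_nonneg _) zero_le_two)]
      exact fun h2 => h ⟨h1, h2⟩
    rw [sFun, extendTop]
    exact if_neg h0
  · rfl

theorem fenchelG_ne_bot (c₀ c₁ : ℝ) (q₀ l : X → ℝ) : fenchelG c₀ c₁ q₀ l ≠ ⊥ := by
  by_cases h : ∑ x, (l - q₀) x = 0 ∧ l1Norm (l - q₀) / 2 ≤ c₀ * c₁
  · rw [fenchelG_of_mem h.1 h.2]
    exact EReal.coe_ne_bot _
  · rw [fenchelG_of_not_mem h]
    exact top_ne_bot

theorem fenchelConj_fenchelG [Nonempty X] {c₀ c₁ : ℝ} (hc₀ : 0 ≤ c₀) (hc₁ : 0 < c₁)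
    (q₀ v : X → ℝ) :
    fenchelConj (fun a b : X → ℝ => a ⬝ᵥ b) (fenchelG c₀ c₁ q₀) (-v)
      = ((c₀ * √(1 + c₁ ^ 2 * spread v ^ 2) - q₀ ⬝ᵥ v : ℝ) : EReal) := by
  classical
  apply le_antisymm
  · refine iSup_le fun l => ?_
    by_cases h : ∑ x, (l - q₀) x = 0 ∧ l1Norm (l - q₀) / 2 ≤ c₀ * c₁
    · rw [fenchelG_of_mem h.1 h.2, ← EReal.coe_sub, EReal.coe_le_coe_iff]
      have h0 : |l1Norm (l - q₀) / 2| ≤ c₀ * c₁ := by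
        rw [abs_of_nonneg (div_nonneg (l1Norm_nonneg _) zero_le_two)]
        exact h.2
      have h1 := linear_add_sqrt_le (s := spread v) hc₀ hc₁ h0
      have h2 := dotProduct_le_l1Norm_mul_spread (l := -(l - q₀))
        (by simpa using congrArg Neg.neg h.1) v
      rw [l1Norm_neg, neg_dotProduct, sub_dotProduct, dotProduct_comm l v] at h2
      change -v ⬝ᵥ l - _ ≤ _
      rw [neg_dotProduct]
      linarith
    · rw [fenchelG_of_not_mem h]
      simp
  · obtain ⟨i, j, hij⟩ := exists_spread_eq v
    set s := spread v with hs
    have hs0 : 0 ≤ s := spread_nonneg v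
    set w := √(1 + c₁ ^ 2 * s ^ 2) with hw
    have hw2 : w ^ 2 = 1 + c₁ ^ 2 * s ^ 2 := Real.sq_sqrt (by positivity)
    have hwp : 0 < w := Real.sqrt_pos.mpr (by positivity)
    -- The maximizer of `a s + √(c₀² - a² / c₁²)`. It is realized by moving mass `a` from a maximum
    -- point `i` of `v` to a minimum point `j`; if `i = j`, then `s = a = 0`.
    set a := c₀ * c₁ ^ 2 * s / w with ha
    have ha0 : 0 ≤ a := by positivity
    set l : X → ℝ := a • (Pi.single j 1 - Pi.single i 1) with hl
    have hn : l1Norm l / 2 = a := by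
      rcases eq_or_ne i j with h | h
      · have hz : s = 0 := by rw [hij, h, sub_self]
        have ha' : a = 0 := by rw [ha, hz]; simp
        simp [hl, ha', l1Norm]
      · have h1 : ∀ x, |l x| = a * ((Pi.single j 1 : X → ℝ) x + (Pi.single i 1 : X → ℝ) x) := by
          intro x
          rw [hl, Pi.smul_apply, smul_eq_mul, abs_mul, abs_of_nonneg ha0, Pi.sub_apply]
          congr 1
          by_cases hx : x = i
          · subst hx
            simp [h]
          · by_cases hx' : x = j
            · subst hx'
              simp [hx]
            · simp [hx, hx']
        simp only [l1Norm, h1, ← Finset.mul_sum, Finset.sum_add_distrib,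
          Finset.sum_pi_single']
        simp only [Finset.mem_univ, if_true]
        ring
    have hsum : ∑ x, l x = 0 := by
      simp [hl, ← Finset.mul_sum]
    have hle : a ≤ c₀ * c₁ := by
      rw [ha, div_le_iff₀ hwp]
      have : c₁ * s ≤ w := Real.le_sqrt_of_sq_le (by nlinarith)
      nlinarith [mul_le_mul_of_nonneg_left this (mul_nonneg hc₀ hc₁.le)]
    have hval : √(c₀ ^ 2 - a ^ 2 / c₁ ^ 2) = c₀ / w := by
      have : c₀ ^ 2 - a ^ 2 / c₁ ^ 2 = (c₀ / w) ^ 2 := by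
        have e : a ^ 2 / c₁ ^ 2 = c₀ ^ 2 * (c₁ ^ 2 * s ^ 2) / w ^ 2 := by
          rw [ha]
          field_simp
        rw [e, div_pow, show c₁ ^ 2 * s ^ 2 = w ^ 2 - 1 by rw [hw2]; ring]
        field_simp
        ring
      rw [this, Real.sqrt_sq (by positivity)]
    have hd : v ⬝ᵥ l = -(a * s) := by
      rw [hl, dotProduct_smul, dotProduct_sub, hij]
      simp
      ring
    refine le_trans (le_of_eq ?_) (le_iSup _ (q₀ + l))
    rw [fenchelG_of_mem (by simpa using hsum) (by simpa [hn] using hle), ← EReal.coe_sub,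
      EReal.coe_eq_coe_iff]
    change _ = -v ⬝ᵥ (q₀ + l) - _
    rw [add_sub_cancel_left, hn, hval, neg_dotProduct, dotProduct_add, hd, dotProduct_comm v q₀]
    have : a * s + c₀ / w = c₀ * w := by
      have e : c₀ * w = c₀ * w ^ 2 / w := by field_simp
      rw [e, hw2, ha]
      ring
    linarith

end Conjugates

/-! ### Identification of the two problems with the Fenchel pair -/

section Problem

variable {n X S P : Type*} [Fintype n] [DecidableEq n] [Fintype X] [Fintype S] [Fintype P]

theorem sum_measMap {M : X → Matrix n n ℂ} (hM : IsPOVM M) (ρ : Matrix n n ℂ) :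
    ∑ x, measMap M ρ x = ρ.trace.re := by
  have h : ∑ x, measMap M ρ x = ((ρ * ∑ x, M x).trace).re := by
    rw [Matrix.mul_sum, Matrix.trace_sum, Complex.re_sum]
    rfl
  rw [h, hM.sum_eq_one, Matrix.mul_one]

omit [DecidableEq n] in
theorem trace_eq_one_iff {ρ : Matrix n n ℂ} (hρ : ρ.PosSemidef) :
    ρ.trace = 1 ↔ ρ.trace.re = 1 := by
  have h := (Complex.nonneg_iff.mp hρ.trace_nonneg).2
  rw [Complex.ext_iff]
  simp [← h]

/-- The outcome weights of ρ sum to `Tr ρ` and `q₀` sums to 1, so for `ρ ≥ 0` the sum-zero condition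
in the penalty is the trace constraint. -/
theorem extendTop_primalObj {M : X → Matrix n n ℂ} (hM : IsPOVM M) (N : S × P → Matrix n n ℂ)
    (c₀ c₁ : ℝ) {q₀ : X → ℝ} (hq₀ : ∑ x, q₀ x = 1) (ρ : Matrix n n ℂ) :
    extendTop (primalFeasible M c₀ c₁ q₀) (primalObj N M c₀ c₁ q₀) ρ
      = fenchelPrimalObj (fenchelF N) (fenchelG c₀ c₁ q₀) (measMap M) ρ := by
  unfold fenchelPrimalObj
  have hnorm : l1Norm (measMap M ρ - q₀) = l1Norm (q₀ - measMap M ρ) := by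
    rw [← l1Norm_neg, neg_sub]
  by_cases hρ : ρ.PosSemidef
  · have hF : fenchelF N ρ = (condEntropyFun N ρ : EReal) := if_pos hρ
    have hiff : ρ ∈ primalFeasible M c₀ c₁ q₀ ↔
        ∑ x, (measMap M ρ - q₀) x = 0 ∧ l1Norm (measMap M ρ - q₀) / 2 ≤ c₀ * c₁ := by
      simp only [primalFeasible, Set.mem_ofPred_eq, hρ, and_true, trace_eq_one_iff hρ, hnorm,
        Pi.sub_apply, Finset.sum_sub_distrib, sum_measMap hM, hq₀, sub_eq_zero]
      rw [div_le_iff₀ two_pos, mul_assoc, mul_comm 2]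
    rw [hF, extendTop]
    by_cases h : ρ ∈ primalFeasible M c₀ c₁ q₀
    · rw [if_pos h, fenchelG_of_mem (hiff.mp h).1 (hiff.mp h).2, ← EReal.coe_add, hnorm, primalObj]
      congr 1
      rw [sub_eq_add_neg]
      congr 4
      ring
    · rw [if_neg h, fenchelG_of_not_mem fun h' => h (hiff.mpr h'), EReal.coe_add_top]
  · have hF : fenchelF N ρ = ⊤ := if_neg hρ
    have h : ρ ∉ primalFeasible M c₀ c₁ q₀ := fun h => hρ h.2.2
    rw [hF, EReal.top_add_of_ne_bot (fenchelG_ne_bot _ _ _ _), extendTop, if_neg h]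

/-- Both sides are homogeneous, so normalize the trace; a positive operator of trace zero vanishes.
-/
theorem dotProduct_measMap_le {M : X → Matrix n n ℂ} {N : S × P → Matrix n n ℂ}
    (hN : ∀ k, (N k).PosSemidef) {v : X → ℝ} (hv : v ∈ dualFeasible N M) {ρ : Matrix n n ℂ}
    (hρ : ρ.PosSemidef) : v ⬝ᵥ measMap M ρ ≤ condEntropyFun N ρ := by
  obtain ⟨hr, him⟩ := Complex.nonneg_iff.mp hρ.trace_nonneg
  rcases hr.eq_or_lt with h | h
  · have h0 : ρ.trace = 0 := Complex.ext h.symm him.symm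
    rw [hρ.trace_eq_zero_iff.mp h0]
    simp [condEntropyFun_zero]
  · set r := ρ.trace.re with hrdef
    have hst : r⁻¹ • ρ ∈ densityOperators n := by
      refine ⟨hρ.smul (inv_nonneg.mpr hr), ?_⟩
      rw [trace_eq_one_iff (hρ.smul (inv_nonneg.mpr hr)), Matrix.trace_smul, Complex.real_smul,
        Complex.re_ofReal_mul, ← hrdef, inv_mul_cancel₀ h.ne']
    have h1 := hv _ hst
    rw [map_smul, dotProduct_smul, condEntropyFun_smul hN hρ.isHermitian, smul_eq_mul] at h1
    exact le_of_mul_le_mul_left h1 (inv_pos.mpr h)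

theorem fenchelConj_fenchelF_of_mem {M : X → Matrix n n ℂ} (hM : IsPOVM M)
    {N : S × P → Matrix n n ℂ} (hN : ∀ k, (N k).PosSemidef) {v : X → ℝ}
    (hv : v ∈ dualFeasible N M) :
    fenchelConj hsInner (fenchelF N) (measMapAdjoint M v) = 0 := by
  apply le_antisymm
  · refine iSup_le fun ρ => ?_
    rw [hsInner_measMapAdjoint hM, fenchelF, extendTop]
    split_ifs with h
    · rw [← EReal.coe_sub, ← EReal.coe_zero, EReal.coe_le_coe_iff, sub_nonpos]
      exact dotProduct_measMap_le hN hv h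
    · simp
  · refine le_trans (le_of_eq ?_) (le_iSup _ 0)
    have h : fenchelF N (0 : Matrix n n ℂ) = ((condEntropyFun N 0 : ℝ) : EReal) :=
      if_pos Matrix.PosSemidef.zero
    rw [hsInner_measMapAdjoint hM, h, condEntropyFun_zero]
    simp

theorem fenchelConj_fenchelF_of_not_mem {M : X → Matrix n n ℂ} (hM : IsPOVM M)
    {N : S × P → Matrix n n ℂ} (hN : ∀ k, (N k).PosSemidef) {v : X → ℝ}
    (hv : v ∉ dualFeasible N M) :
    fenchelConj hsInner (fenchelF N) (measMapAdjoint M v) = ⊤ := by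
  simp only [dualFeasible, Set.mem_ofPred_eq, not_forall, not_le] at hv
  obtain ⟨ρ, hρ, hlt⟩ := hv
  rw [EReal.eq_top_iff_forall_lt]
  intro C
  set δ := v ⬝ᵥ measMap M ρ - condEntropyFun N ρ with hδ
  have hδp : 0 < δ := sub_pos.mpr hlt
  have hs : 0 ≤ (|C| + 1) / δ := by positivity
  -- Scaling a violating state by this factor turns its excess `δ` into `|C| + 1`.
  refine lt_of_lt_of_le ?_ (le_iSup _ (((|C| + 1) / δ) • ρ))
  have h : fenchelF N (((|C| + 1) / δ) • ρ)
      = ((condEntropyFun N (((|C| + 1) / δ) • ρ) : ℝ) : EReal) := if_pos (hρ.1.smul hs)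
  rw [hsInner_measMapAdjoint hM, h, condEntropyFun_smul hN hρ.1.isHermitian, map_smul,
    dotProduct_smul, smul_eq_mul, ← EReal.coe_sub, ← mul_sub, ← hδ, EReal.coe_lt_coe_iff,
    div_mul_cancel₀ _ hδp.ne']
  linarith [le_abs_self C]

theorem extendBot_dualObj [Nonempty X] {M : X → Matrix n n ℂ} (hM : IsPOVM M)
    {N : S × P → Matrix n n ℂ} (hN : ∀ k, (N k).PosSemidef) {c₀ c₁ : ℝ} (hc₀ : 0 ≤ c₀)
    (hc₁ : 0 < c₁) (q₀ v : X → ℝ) :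
    extendBot (dualFeasible N M) (dualObj c₀ c₁ q₀) v
      = fenchelDualObj hsInner (fun a b : X → ℝ => a ⬝ᵥ b) (fenchelF N) (fenchelG c₀ c₁ q₀)
          (measMapAdjoint M) v := by
  rw [fenchelDualObj, fenchelConj_fenchelG hc₀ hc₁, extendBot]
  split_ifs with h
  · rw [fenchelConj_fenchelF_of_mem hM hN h, neg_zero, zero_sub, ← EReal.coe_neg, dualObj]
    congr 1
    ring
  · rw [fenchelConj_fenchelF_of_not_mem hM hN h]
    simp

/-! ### Weak duality and the minimax argument -/

theorem hDual_le_hPrimal [Nonempty X] {M : X → Matrix n n ℂ} (hM : IsPOVM M)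
    (N : S × P → Matrix n n ℂ) {c₀ c₁ : ℝ} (hc₀ : 0 ≤ c₀)
    (hc₁ : 0 < c₁) {q₀ : X → ℝ} (hq₀ : ∑ x, q₀ x = 1) :
    hDual N M c₀ c₁ q₀ ≤ hPrimal N M c₀ c₁ q₀ := by
  refine iSup₂_le fun v hv => le_iInf₂ fun ρ hρ => ?_
  rw [EReal.coe_le_coe_iff, dualObj, primalObj]
  obtain ⟨htr, hle, hpos⟩ := hρ
  have hsum : ∑ x, (q₀ - measMap M ρ) x = 0 := by
    simp only [Pi.sub_apply, Finset.sum_sub_distrib, sum_measMap hM, hq₀, htr, Complex.one_re,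
      sub_self]
  have h1 := hv ρ ⟨hpos, htr⟩
  have h2 := dotProduct_le_l1Norm_mul_spread hsum v
  have h0 : |l1Norm (q₀ - measMap M ρ) / 2| ≤ c₀ * c₁ := by
    rw [abs_of_nonneg (div_nonneg (l1Norm_nonneg _) zero_le_two)]
    linarith
  have h3 := linear_add_sqrt_le (s := spread v) hc₀ hc₁ h0
  rw [show l1Norm (q₀ - measMap M ρ) ^ 2 / (4 * c₁ ^ 2)
    = (l1Norm (q₀ - measMap M ρ) / 2) ^ 2 / c₁ ^ 2 by ring]
  rw [sub_dotProduct, dotProduct_comm (measMap M ρ)] at h2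
  linarith

/-- The function whose saddle value is the common value of the two problems; `s` is an upper
bound for `spread v`. -/
def saddleFun (N : S × P → Matrix n n ℂ) (M : X → Matrix n n ℂ) (c₀ c₁ : ℝ) (q₀ : X → ℝ)
    (ρ : Matrix n n ℂ) (y : (X → ℝ) × ℝ) : ℝ :=
  condEntropyFun N ρ + (q₀ - measMap M ρ) ⬝ᵥ y.1 - c₀ * √(1 + c₁ ^ 2 * y.2 ^ 2)

/-- The pairs of a vector and an upper bound for its spread. -/
def spreadBounds (X : Type*) : Set ((X → ℝ) × ℝ) := {y | ∀ i j, y.1 i - y.1 j ≤ y.2}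

omit [Fintype X] in
theorem convex_spreadBounds : Convex ℝ (spreadBounds X) := by
  intro y hy z hz a b ha hb _ i j
  have h1 := mul_le_mul_of_nonneg_left (hy i j) ha
  have h2 := mul_le_mul_of_nonneg_left (hz i j) hb
  simp only [Prod.fst_add, Prod.smul_fst, Pi.add_apply, Pi.smul_apply, smul_eq_mul, Prod.snd_add,
    Prod.smul_snd]
  linarith

omit [Fintype X] in
theorem continuous_measMap (M : X → Matrix n n ℂ) : Continuous (measMap M) := by
  refine continuous_pi fun x => ?_
  change Continuous fun σ : Matrix n n ℂ => (Matrix.trace (σ * M x)).re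
  fun_prop

/-- Sion's theorem, with compactness on the side of the states. Using a free bound for the spread as
a second coordinate makes continuity and concavity in `y` immediate. -/
theorem iInf_iSup_saddleFun {N : S × P → Matrix n n ℂ} (hN : ∀ k, (N k).PosSemidef)
    (M : X → Matrix n n ℂ) {c₀ : ℝ} (hc₀ : 0 ≤ c₀) (c₁ : ℝ) (q₀ : X → ℝ)
    (hne : (densityOperators n).Nonempty) :
    ⨅ ρ ∈ densityOperators n, ⨆ y ∈ spreadBounds X, (saddleFun N M c₀ c₁ q₀ ρ y : EReal)
      = ⨆ y ∈ spreadBounds X, ⨅ ρ ∈ densityOperators n, (saddleFun N M c₀ c₁ q₀ ρ y : EReal) := by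
  have hmono : Monotone ((↑) : ℝ → EReal) := EReal.coe_strictMono.monotone
  have hcM := continuous_measMap M
  refine Sion.minimax' hne convex_densityOperators isCompact_densityOperators ?_ ?_
    convex_spreadBounds ?_ ?_
  · intro y _
    refine (continuous_coe_real_ereal.comp_continuousOn ?_).lowerSemicontinuousOn
    refine (ContinuousOn.add ?_ ?_).sub continuousOn_const
    · exact (continuousOn_condEntropyFun N).mono fun ρ hρ => hρ.1.isHermitian
    · exact Continuous.continuousOn (by fun_prop)
  · intro y _
    suffices h : ConvexOn ℝ (densityOperators n) fun ρ => saddleFun N M c₀ c₁ q₀ ρ y by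
      have := h.quasiconvexOn.monotone_comp hmono
      exact this
    have hW : ConvexOn ℝ (densityOperators n) (condEntropyFun N) :=
      (convexOn_condEntropyFun hN).subset (fun ρ hρ => hρ.1) convex_densityOperators
    refine ⟨convex_densityOperators, fun ρ hρ σ hσ a b ha hb hab => ?_⟩
    have h := hW.2 hρ hσ ha hb hab
    simp only [saddleFun, smul_eq_mul, map_add, map_smul, sub_dotProduct, add_dotProduct,
      smul_dotProduct] at h ⊢
    have hb' : b = 1 - a := by linarith
    subst hb'
    linarith
  · intro ρ _
    refine (continuous_coe_real_ereal.comp ?_).upperSemicontinuous.upperSemicontinuousOn _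
    unfold saddleFun
    fun_prop
  · intro ρ _
    suffices h : ConcaveOn ℝ (spreadBounds X) (saddleFun N M c₀ c₁ q₀ ρ) by
      have := h.quasiconcaveOn.monotone_comp hmono
      exact this
    refine ⟨convex_spreadBounds, fun y _ z _ a b ha hb hab => ?_⟩
    have h := mul_le_mul_of_nonneg_left ((convexOn_sqrt_one_add_sq c₁).2 (Set.mem_univ y.2)
      (Set.mem_univ z.2) ha hb hab) hc₀
    simp only [saddleFun, smul_eq_mul, Prod.fst_add, Prod.snd_add, Prod.smul_fst, Prod.smul_snd,
      dotProduct_add, dotProduct_smul] at h ⊢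
    have hb' : b = 1 - a := by linarith
    subst hb'
    linarith

theorem hPrimal_le_iInf_iSup_saddleFun (N : S × P → Matrix n n ℂ)
    (M : X → Matrix n n ℂ) {c₀ c₁ : ℝ} (hc₀ : 0 ≤ c₀) (hc₁ : 0 < c₁) (q₀ : X → ℝ) :
    hPrimal N M c₀ c₁ q₀ ≤
      ⨅ ρ ∈ densityOperators n, ⨆ y ∈ spreadBounds X, (saddleFun N M c₀ c₁ q₀ ρ y : EReal) := by
  refine le_iInf₂ fun ρ hρ => ?_
  set l := q₀ - measMap M ρ with hl
  have ha : 0 ≤ l1Norm l / 2 := div_nonneg (l1Norm_nonneg _) zero_le_two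
  refine EReal.le_of_forall_lt_iff_le.mp fun r hr => ?_
  by_contra! hlt
  obtain ⟨s, hs, h⟩ := exists_linear_sub_gt (r := r - condEntropyFun N ρ) hc₀ hc₁ ha fun hle => by
    have hmem : ρ ∈ primalFeasible M c₀ c₁ q₀ := ⟨hρ.2, by rw [← hl]; linarith, hρ.1⟩
    have h1 := lt_of_lt_of_le hlt (iInf₂_le ρ hmem)
    rw [EReal.coe_lt_coe_iff, primalObj, ← hl,
      show l1Norm l ^ 2 / (4 * c₁ ^ 2) = (l1Norm l / 2) ^ 2 / c₁ ^ 2 by ring] at h1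
    linarith
  have hsign : ∀ x, |(SignType.sign (l x) : ℝ)| ≤ 1 := fun x => by
    cases SignType.sign (l x) <;> simp
  -- The sign vector scaled by `s / 2` gives equality in the ℓ¹–spread pairing.
  have hy : ((fun x => s / 2 * SignType.sign (l x), s) : (X → ℝ) × ℝ) ∈ spreadBounds X := by
    intro i j
    have h1 := abs_le.mp (hsign i)
    have h2 := abs_le.mp (hsign j)
    dsimp only
    nlinarith
  have hlt' := lt_of_le_of_lt (le_iSup₂ (f := fun y (_ : y ∈ spreadBounds X) =>
    (saddleFun N M c₀ c₁ q₀ ρ y : EReal)) _ hy) hr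
  have hd : (l ⬝ᵥ fun x => s / 2 * (SignType.sign (l x) : ℝ)) = l1Norm l / 2 * s := by
    simp only [dotProduct, l1Norm, Finset.sum_div, Finset.sum_mul]
    refine Finset.sum_congr rfl fun x _ => ?_
    rw [← sign_mul_self (l x)]
    ring
  rw [EReal.coe_lt_coe_iff, saddleFun, ← hl, hd] at hlt'
  linarith

/-- Add to the vector the minimum `c` of `W(ρ) - y · Φ_M(ρ)` over states. Outcome weights of states
sum to 1, so the result is dual feasible; as `q₀` also sums to 1, the linear term gains exactly `c`,
and the spread is unchanged. -/
theorem iSup_iInf_saddleFun_le_hDual [Nonempty X] {N : S × P → Matrix n n ℂ}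
    {M : X → Matrix n n ℂ} (hM : IsPOVM M) {c₀ : ℝ} (hc₀ : 0 ≤ c₀) (c₁ : ℝ) {q₀ : X → ℝ}
    (hq₀ : ∑ x, q₀ x = 1) (hne : (densityOperators n).Nonempty) :
    ⨆ y ∈ spreadBounds X, ⨅ ρ ∈ densityOperators n, (saddleFun N M c₀ c₁ q₀ ρ y : EReal)
      ≤ hDual N M c₀ c₁ q₀ := by
  refine iSup₂_le fun y hy => ?_
  have hcM := continuous_measMap M
  have hc : ContinuousOn (fun ρ => condEntropyFun N ρ - y.1 ⬝ᵥ measMap M ρ)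
      (densityOperators n) :=
    ((continuousOn_condEntropyFun N).mono fun ρ hρ => hρ.1.isHermitian).sub
      (Continuous.continuousOn (by fun_prop))
  obtain ⟨σ, hσ, hmin⟩ := isCompact_densityOperators.exists_isMinOn hne hc
  set c := condEntropyFun N σ - y.1 ⬝ᵥ measMap M σ with hcdef
  have hadd : ∀ w : X → ℝ, (fun x => y.1 x + c) ⬝ᵥ w = y.1 ⬝ᵥ w + c * ∑ x, w x := fun w => by
    simp only [dotProduct, add_mul, Finset.sum_add_distrib, Finset.mul_sum]
  have hv : (fun x => y.1 x + c) ∈ dualFeasible N M := by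
    intro ρ hρ
    have h := isMinOn_iff.mp hmin ρ hρ
    rw [hadd, sum_measMap hM, hρ.2, Complex.one_re, mul_one]
    linarith
  refine (iInf₂_le σ hσ).trans (le_trans ?_ (le_iSup₂ _ hv))
  rw [EReal.coe_le_coe_iff, saddleFun, dualObj, dotProduct_comm q₀, hadd, hq₀, spread_add_const,
    mul_one, sub_dotProduct, dotProduct_comm q₀, dotProduct_comm (measMap M σ)]
  have h1 : spread y.1 ^ 2 ≤ y.2 ^ 2 := pow_le_pow_left₀ (spread_nonneg _) (spread_le hy) 2
  have h2 : c₀ * √(1 + c₁ ^ 2 * spread y.1 ^ 2) ≤ c₀ * √(1 + c₁ ^ 2 * y.2 ^ 2) := by gcongr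
  linarith

end Problem

end

theorem mainTheorem7 {n X S P : Type*} [Fintype n] [DecidableEq n] [Fintype X] [Fintype S]
    [Fintype P]
    (N : S × P → Matrix n n ℂ) (hN : IsPOVM N)
    (M : X → Matrix n n ℂ) (hM : IsPOVM M)
    (c₀ c₁ : ℝ) (hc₀ : 0 ≤ c₀) (hc₁ : 0 < c₁)
    (q₀ : X → ℝ) (hq₀ : q₀ ∈ stdSimplex ℝ X) :
    -- the primal problem is the Fenchel problem of `f`, `g` and `Φ_M`
    (∀ ρ : Matrix n n ℂ,
      extendTop (primalFeasible M c₀ c₁ q₀) (primalObj N M c₀ c₁ q₀) ρ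
        = fenchelPrimalObj (fenchelF N) (fenchelG c₀ c₁ q₀) (measMap M) ρ) ∧
    hPrimal N M c₀ c₁ q₀
      = ⨅ ρ, fenchelPrimalObj (fenchelF N) (fenchelG c₀ c₁ q₀) (measMap M) ρ ∧
    -- its Fenchel dual is the maximization problem over `f`
    (∀ v : X → ℝ,
      extendBot (dualFeasible N M) (dualObj c₀ c₁ q₀) v
        = fenchelDualObj hsInner (fun a b : X → ℝ => a ⬝ᵥ b) (fenchelF N) (fenchelG c₀ c₁ q₀)
            (measMapAdjoint M) v) ∧
    hDual N M c₀ c₁ q₀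
      = ⨆ v, fenchelDualObj hsInner (fun a b : X → ℝ => a ⬝ᵥ b) (fenchelF N)
          (fenchelG c₀ c₁ q₀) (measMapAdjoint M) v ∧
    -- strong duality
    ((∃ σ ∈ densityOperators n, measMap M σ = q₀) →
      hPrimal N M c₀ c₁ q₀ = hDual N M c₀ c₁ q₀) := by
  have : Nonempty X := by
    by_contra h
    rw [not_nonempty_iff] at h
    simpa using hq₀.2
  have hp := extendTop_primalObj hM N c₀ c₁ hq₀.2
  have hd := extendBot_dualObj hM hN.posSemidef hc₀ hc₁ q₀
  refine ⟨hp, ?_, hd, ?_, ?_⟩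
  · rw [hPrimal, ← iInf_extendTop]
    exact iInf_congr hp
  · rw [hDual, ← iSup_extendBot]
    exact iSup_congr hd
  · rintro ⟨σ, hσ, -⟩
    refine le_antisymm ?_ (hDual_le_hPrimal hM N hc₀ hc₁ hq₀.2)
    refine (hPrimal_le_iInf_iSup_saddleFun N M hc₀ hc₁ q₀).trans ?_
    rw [iInf_iSup_saddleFun hN.posSemidef M hc₀ c₁ q₀ ⟨σ, hσ⟩]
    exact iSup_iInf_saddleFun_le_hDual hM hc₀ c₁ hq₀.2 ⟨σ, hσ⟩
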